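/- Let $n\ge 3$. Let $L=\mathfrak{sl}_n(\mathbb C)$ be the Lie algebra of traceless complex $n\times n$ matrices, and let $\mathcal D: L=H_0\oplus H_1\oplus\cdots\oplus H_n$ be an orthogonal decomposition, i.e. a direct sum decomposition into Cartan subalgebras (nilpotent, self-normalizing subalgebras) that are pairwise orthogonal with respect to the Killing form; assume that each $H_i$ is closed under the adjoint, $H_i^*=H_i$, where $A^*=\overline{A}^{\,t}$. Let $\mathcal B=\{B_0,B_1,\dots,B_n\}$ be the corresponding complete set of mutually unbiased bases: each $B_i$ is an orthonormal basis of $\mathbb C^n$, $|(x,y)|^2=1/n$ for all vectors $x,y$ from distinct bases, and $H_i$ consists of all traceless matrices for which every vector of $B_i$ is an eigenvector. Put $$\mathrm{Aut}(\mathcal D)=\{\varphi\in\mathrm{Aut}(L)\mid(\forall i)(\exists j)\ \varphi(H_i)=H_j\}.$$ Let $\mathrm{Ort}(B_i)$ be the set of the $1$-dimensional subspaces of $\mathbb C^n$ generated by the vectors of $B_i$, let $\tau$ be the coordinatewise complex conjugation, let $PGL_n(\mathbb C)^+=PGL_n(\mathbb C)\langle\tau\rangle$ be the group of transformations of the set of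 $1$-dimensional subspaces of $\mathbb C^n$ generated by $PGL_n(\mathbb C)$ and $\tau$, and put $$\mathrm{Aut}(\mathcal B)=\{\psi\in PGL_n(\mathbb C)^+\mid(\forall i)(\exists j)\ \psi(\mathrm{Ort}(B_i))=\mathrm{Ort}(B_j)\}.$$ Then the groups $\mathrm{Aut}(\mathcal D)$ and $\mathrm{Aut}(\mathcal B)$ are isomorphic. -/

import Mathlib

open scoped Matrix MatrixGroups LinearAlgebra.Projectivization

-- Associative algebras carry the commutator bracket.
attribute [local instance 100] LieRing.ofAssociativeRing

noncomputable section

namespace MUB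

/-- The Lie algebra `sl_n(ℂ)` of traceless `n × n` complex matrices with the commutator bracket. -/
abbrev SL (n : ℕ) : LieSubalgebra ℂ (Matrix (Fin n) (Fin n) ℂ) :=
  LieAlgebra.SpecialLinear.sl (Fin n) ℂ

/-- The adjoint (conjugate transpose) of a traceless matrix. -/
def adjoint {n : ℕ} (A : SL n) : SL n :=
  ⟨(A : Matrix (Fin n) (Fin n) ℂ)ᴴ, by
    have h : Matrix.trace (A : Matrix (Fin n) (Fin n) ℂ) = 0 := A.2
    change Matrix.trace (A : Matrix (Fin n) (Fin n) ℂ)ᴴ = 0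
    rw [Matrix.trace_conjTranspose, h, star_zero]⟩

/-- An orthogonal decomposition `sl_n(ℂ) = H₀ ⊕ ⋯ ⊕ Hₙ`: a direct sum of Cartan subalgebras
that are pairwise orthogonal with respect to the Killing form. -/
structure OrthogonalDecomposition (n : ℕ) where
  H : Fin (n + 1) → LieSubalgebra ℂ (SL n)
  cartan : ∀ i, (H i).IsCartanSubalgebra
  isInternal : DirectSum.IsInternal fun i => (H i).toSubmodule
  orthogonal : ∀ i j, i ≠ j → ∀ A ∈ H i, ∀ B ∈ H j, killingForm ℂ (SL n) A B = 0

/-- Every summand satisfies `H* = H`. -/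
def OrthogonalDecomposition.IsAdjointClosed {n : ℕ} (D : OrthogonalDecomposition n) : Prop :=
  ∀ i, adjoint '' (D.H i : Set (SL n)) = D.H i

/-- A complete set of mutually unbiased bases of `ℂⁿ`: `n + 1` orthonormal bases with
`|(x, y)|² = 1 / n` for all `x`, `y` from distinct bases. -/
structure CompleteMUB (n : ℕ) where
  B : Fin (n + 1) → OrthonormalBasis (Fin n) ℂ (EuclideanSpace ℂ (Fin n))
  unbiased : ∀ i j, i ≠ j → ∀ k l, ‖inner ℂ (B i k) (B j l)‖ ^ 2 = 1 / (n : ℝ)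

/-- `D` corresponds to `ℬ`: the summand `H i` consists of all traceless matrices that are diagonal
with respect to the basis `B i`, i.e. have all the vectors of `B i` as eigenvectors. -/
def Corresponds {n : ℕ} (D : OrthogonalDecomposition n) (ℬ : CompleteMUB n) : Prop :=
  ∀ i, ∀ A : SL n, A ∈ D.H i ↔
    ∀ k, ∃ c : ℂ, (A : Matrix (Fin n) (Fin n) ℂ) *ᵥ (ℬ.B i k).ofLp = c • (ℬ.B i k).ofLp

/-- The group of Lie algebra automorphisms, with composition as multiplication. -/
instance lieAutGroup {R L : Type*} [CommRing R] [LieRing L] [LieAlgebra R L] :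
    Group (L ≃ₗ⁅R⁆ L) where
  mul f g := g.trans f
  inv f := f.symm
  mul_assoc _ _ _ := rfl
  one_mul _ := rfl
  mul_one _ := rfl
  inv_mul_cancel f := by
    apply LieEquiv.ext
    intro x
    exact f.symm_apply_apply x

/-- If a permutation sends each of finitely many sets to one of them, so does its inverse. -/
theorem inv_permutes {X ι : Type*} [Finite ι] (S : ι → Set X) (f : Equiv.Perm X)
    (h : ∀ i, ∃ j, f '' S i = S j) (i : ι) : ∃ j, (f⁻¹ : Equiv.Perm X) '' S i = S j := by
  have hmaps : Set.MapsTo (fun s : Set X => f '' s) (Set.range S) (Set.range S) := by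
    rintro _ ⟨k, rfl⟩
    obtain ⟨j, hj⟩ := h k
    exact ⟨j, hj.symm⟩
  have hinj : Function.Injective (hmaps.restrict _ _ _) := fun s t hst =>
    Subtype.ext (f.injective.image_injective (congrArg Subtype.val hst))
  obtain ⟨⟨_, ⟨j, rfl⟩⟩, hj⟩ := Finite.surjective_of_injective hinj ⟨S i, i, rfl⟩
  replace hj : f '' S j = S i := congrArg Subtype.val hj
  refine ⟨j, ?_⟩
  rw [← hj]
  ext x
  simp

/-- The group of Lie algebra automorphisms `φ` with `(∀ i) (∃ j) φ(Hᵢ) = Hⱼ`. -/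
def OrthogonalDecomposition.Aut {n : ℕ} (D : OrthogonalDecomposition n) :
    Subgroup (SL n ≃ₗ⁅ℂ⁆ SL n) where
  carrier := {φ | ∀ i, ∃ j, φ '' (D.H i : Set (SL n)) = D.H j}
  one_mem' i := ⟨i, Set.image_id _⟩
  mul_mem' {φ ψ} hφ hψ i := by
    obtain ⟨j, hj⟩ := hψ i
    obtain ⟨k, hk⟩ := hφ j
    refine ⟨k, ?_⟩
    rw [← hk, ← hj, Set.image_image]
    rfl
  inv_mem' {φ} hφ i := inv_permutes (fun i => (D.H i : Set (SL n))) φ.toLinearEquiv.toEquiv hφ i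

/-- The 1-space in `ℂⁿ` spanned by the `k`-th vector of an orthonormal basis. -/
def line {n : ℕ} (b : OrthonormalBasis (Fin n) ℂ (EuclideanSpace ℂ (Fin n))) (k : Fin n) :
    ℙ ℂ (Fin n → ℂ) :=
  Projectivization.mk ℂ (b k).ofLp fun h => b.orthonormal.ne_zero k (by
    ext x
    exact congrFun h x)

/-- The orthoframe of an orthonormal basis: the set of 1-spaces spanned by its vectors. -/
def Ort {n : ℕ} (b : OrthonormalBasis (Fin n) ℂ (EuclideanSpace ℂ (Fin n))) :
    Set (ℙ ℂ (Fin n → ℂ)) :=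
  Set.range (line b)

/-- The map `τ` on 1-spaces induced by coordinatewise complex conjugation of vectors. -/
def conj (n : ℕ) : Equiv.Perm (ℙ ℂ (Fin n → ℂ)) :=
  Function.Involutive.toPerm
    (Projectivization.map (starLinearEquiv ℂ (A := Fin n → ℂ)).toLinearMap
      (starLinearEquiv ℂ (A := Fin n → ℂ)).injective)
    (by
      intro x
      induction x using Projectivization.ind with
      | _ v hv => simp [Projectivization.map_mk])

/-- `PGL_n(ℂ)⁺ = PGL_n(ℂ)⟨τ⟩`, the group of transformations of the set of 1-spaces of `ℂⁿ`
generated by the projective linear maps and by the conjugation `τ`. -/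
def PGLPlus (n : ℕ) : Subgroup (Equiv.Perm (ℙ ℂ (Fin n → ℂ))) :=
  (MulAction.toPermHom PGL(n, ℂ) (ℙ ℂ (Fin n → ℂ))).range ⊔ Subgroup.zpowers (conj n)

/-- The group of all `ψ ∈ PGL_n(ℂ)⁺` with `(∀ i) (∃ j) ψ(Ort(Bᵢ)) = Ort(Bⱼ)`. -/
def CompleteMUB.Aut {n : ℕ} (ℬ : CompleteMUB n) : Subgroup (PGLPlus n) where
  carrier := {ψ | ∀ i, ∃ j, (ψ : Equiv.Perm (ℙ ℂ (Fin n → ℂ))) '' Ort (ℬ.B i) = Ort (ℬ.B j)}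
  one_mem' i := ⟨i, by simp⟩
  mul_mem' {φ ψ} hφ hψ i := by
    obtain ⟨j, hj⟩ := hψ i
    obtain ⟨k, hk⟩ := hφ j
    refine ⟨k, ?_⟩
    rw [← hk, ← hj, Set.image_image]
    rfl
  inv_mem' {ψ} hψ i := inv_permutes (fun i => Ort (ℬ.B i)) ψ.1 hψ i

end MUB

end

noncomputable section

namespace MUB

/-! ### Lie automorphisms of the full matrix algebra preserving the diagonal matrices -/

section Classification

variable {ι K : Type*} [Fintype ι] [DecidableEq ι] [Field K]

/-! Both groups are described by matrices, and the isomorphism is found as its graph. Inside the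
product of the automorphism group of `sl_n` and the permutation group of the 1-spaces,
`correspondence n` consists of the pairs (conjugation by `g`, projective map of `g`), with `g`
unitary up to a scalar, and of their products with (`A ↦ -Aᵀ`, `τ`). Cut down to `D.Aut × ℬ.Aut`,
both of its projections turn out to be bijective.

Surjectivity has three ingredients. First, an automorphism carrying `H 0` to some `H j` becomes,
after a change of bases, one that preserves the diagonal matrices. Weights and the Killing form then
show that it is a conjugation, possibly composed with `A ↦ -Aᵀ` (`exists_conj_of_map_diagonal`); the
extension to all matrices by the identity on scalars makes the diagonal matrix units available.

Second, `H i` and `Ort (B i)` determine each other through the relation "`ℓ` is an eigenline of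
`A`". This relation is invariant under conjugation paired with the projective map, and under
entrywise complex conjugation paired with `τ` (`image_eq_iff`). Since `H i` is closed under the
adjoint, its images under `A ↦ -Aᵀ` and under entrywise conjugation agree.

Third, if `g`, or `g` after `τ`, permutes the orthoframes, then `g* g` or its complex conjugate is
diagonal in every `B i`. Its traceless part lies in every `H i`, hence vanishes, and `g` is unitary
up to a scalar. This is needed for the pairs to form a group: `A ↦ -Aᵀ` turns `g` into its inverse
transpose, `τ` turns it into its complex conjugate, and for such `g` the two agree up to a scalar.

Injectivity holds because only scalars act trivially on either side, `A ↦ -Aᵀ` is not inner for `n ≥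
3`, and `τ` is not projective linear for `n ≥ 2`. -/

theorem lie_diagonal_apply (d : ι → K) (A : Matrix ι ι K) (i j : ι) :
    ⁅Matrix.diagonal d, A⁆ i j = (d i - d j) * A i j := by
  rw [Ring.lie_def, Matrix.sub_apply, Matrix.diagonal_mul, Matrix.mul_diagonal]
  ring

theorem lie_diagonal_single (d : ι → K) (i j : ι) :
    ⁅Matrix.diagonal d, Matrix.single i j (1 : K)⁆ = (d i - d j) • Matrix.single i j (1 : K) := by
  ext a b
  rw [lie_diagonal_apply, Matrix.smul_apply, smul_eq_mul]
  by_cases h : i = a ∧ j = b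
  · rw [h.1, h.2]
  · simp [Matrix.single_apply_of_ne _ _ _ _ _ h]

theorem killingForm_diagonal (d e : ι → K) :
    killingForm K (Matrix ι ι K) (Matrix.diagonal d) (Matrix.diagonal e) =
      ∑ i, ∑ j, (d i - d j) * (e i - e j) := by
  rw [killingForm_apply_apply, LinearMap.trace_eq_matrix_trace K (Matrix.stdBasis K ι ι),
    Matrix.trace, Fintype.sum_prod_type]
  refine Finset.sum_congr rfl fun i _ => Finset.sum_congr rfl fun j _ => ?_
  rw [Matrix.diag_apply, LinearMap.toMatrix_apply, Matrix.stdBasis_eq_single]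
  simp only [LinearMap.comp_apply, LieAlgebra.ad_apply, lie_diagonal_single, lie_smul]
  rw [← Matrix.stdBasis_eq_single]
  simp [mul_comm]

omit [DecidableEq ι] in
theorem sum_sum_sub_mul_sub (d e : ι → K) :
    ∑ i, ∑ j, (d i - d j) * (e i - e j) =
      2 * (Fintype.card ι * ∑ i, d i * e i - (∑ i, d i) * ∑ i, e i) := by
  have h : ∀ i j, (d i - d j) * (e i - e j) = d i * e i - d i * e j - (e i * d j - d j * e j) := by
    intro i j
    ring
  simp only [h, Finset.sum_sub_distrib, Finset.sum_const, Finset.card_univ, nsmul_eq_mul]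
  simp only [← Finset.mul_sum, ← Finset.sum_mul]
  ring

variable [CharZero K]

/-- A vector with coordinate differences in `{0, 1, -1}` and the Killing norm of a basis vector is
up to sign and a constant a basis vector. -/
theorem exists_eq_const_add_single (d : ι → K)
    (hd : ∀ i j, d i - d j = 0 ∨ d i - d j = 1 ∨ d i - d j = -1)
    (hsum : ∑ i, ∑ j, (d i - d j) * (d i - d j) = 2 * ((Fintype.card ι : K) - 1))
    (hcard : 2 ≤ Fintype.card ι) :
    ∃ (p : ι) (ε c : K), (ε = 1 ∨ ε = -1) ∧
      ∀ i, d i = c + ε * Pi.single (M := fun _ => K) p 1 i := by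
  have hne : (Fintype.card ι : K) - 1 ≠ 0 := by
    rw [sub_ne_zero]
    exact_mod_cast (by omega : Fintype.card ι ≠ 1)
  obtain ⟨j₀, i₀, h₀⟩ : ∃ j₀ i₀, d i₀ - d j₀ = 1 := by
    by_contra! hcon
    have hz : ∀ i j, d i - d j = 0 := by
      intro i j
      rcases hd i j with h | h | h
      · exact h
      · exact absurd h (hcon j i)
      · exact absurd (by rw [← neg_sub, h, neg_neg]) (hcon i j)
    simp only [hz, mul_zero, Finset.sum_const_zero] at hsum
    exact hne (by simpa using hsum.symm)
  set a := d j₀ with ha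
  -- The value `a - 1` is impossible: it would differ by 2 from the value `a + 1` at `i₀`.
  have hval : ∀ i, d i = a ∨ d i = a + 1 := by
    intro i
    rcases hd i j₀ with h | h | h
    · left; linear_combination h
    · right; linear_combination h
    · exfalso
      have h2 : d i₀ - d i = 2 := by linear_combination h₀ - h
      rcases hd i₀ i with h' | h' | h' <;> rw [h2] at h' <;> norm_num at h'
  classical
  set S : Finset ι := Finset.univ.filter fun i => d i = a + 1 with hS
  have hx : ∀ i, d i - a = if i ∈ S then 1 else 0 := by
    intro i
    by_cases h : d i = a + 1
    · simp [hS, h]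
    · simp [hS, (hval i).resolve_right h]
  have hsum' : (Fintype.card ι : K) * S.card - S.card * S.card = Fintype.card ι - 1 := by
    have h1 : ∑ i, ∑ j, (d i - d j) * (d i - d j)
        = ∑ i, ∑ j, ((d i - a) - (d j - a)) * ((d i - a) - (d j - a)) := by simp
    rw [h1, sum_sum_sub_mul_sub] at hsum
    simp only [hx, ite_mul, one_mul, zero_mul, Finset.sum_ite_mem, Finset.univ_inter] at hsum
    simpa using hsum
  -- With `s` coordinates equal to `a + 1`, the norm condition reads `s (n - s) = n - 1`, whose
  -- roots are `s = 1` and `s = n - 1`; they give the signs `+` and `-`.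
  have hfac : ((S.card : K) - 1) * (Fintype.card ι - 1 - S.card) = 0 := by
    linear_combination hsum'
  rcases mul_eq_zero.1 hfac with h | h
  · have hc : S.card = 1 := by exact_mod_cast sub_eq_zero.1 h
    obtain ⟨p, hp⟩ := Finset.card_eq_one.1 hc
    refine ⟨p, 1, a, Or.inl rfl, fun i => ?_⟩
    have := hx i
    simp only [hp, Finset.mem_singleton] at this
    rw [Pi.single_apply]
    linear_combination this
  · have hc : Sᶜ.card = 1 := by
      have h' : S.card + 1 = Fintype.card ι := by
        have : (S.card : K) + 1 = Fintype.card ι := by linear_combination -h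
        exact_mod_cast this
      rw [Finset.card_compl]
      omega
    obtain ⟨p, hp⟩ := Finset.card_eq_one.1 hc
    refine ⟨p, -1, a + 1, Or.inr rfl, fun i => ?_⟩
    have h1 := hx i
    have h2 : i ∈ S ↔ i ≠ p := by
      rw [ne_eq, ← Finset.mem_singleton, ← hp, Finset.mem_compl, not_not]
    rw [Pi.single_apply]
    by_cases hip : i = p
    · rw [if_neg (fun hi => h2.1 hi hip)] at h1
      rw [if_pos hip]
      linear_combination h1
    · rw [if_pos (h2.2 hip)] at h1
      rw [if_neg hip]
      linear_combination h1

/-- The differences `d i - d j` are the weights of the image on the matrix units, hence eigenvalues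
of the adjoint action of a diagonal matrix unit, which are 0, 1, -1. Invariance of the Killing form
supplies the norm. -/
theorem exists_diagonal_single_image (Φ : Matrix ι ι K ≃ₗ⁅K⁆ Matrix ι ι K)
    (hΦ : ∀ d : ι → K, ∃ e : ι → K, Φ (Matrix.diagonal d) = Matrix.diagonal e)
    (hcard : 2 ≤ Fintype.card ι) (k : ι) :
    ∃ (p : ι) (ε c : K), (ε = 1 ∨ ε = -1) ∧
      Φ (Matrix.diagonal (Pi.single k 1)) =
        Matrix.diagonal fun i => c + ε * Pi.single (M := fun _ => K) p 1 i := by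
  obtain ⟨d, hd⟩ := hΦ (Pi.single k 1)
  have hdiff : ∀ i j, d i - d j = 0 ∨ d i - d j = 1 ∨ d i - d j = -1 := by
    intro i j
    set X := Φ.symm (Matrix.single i j 1) with hX
    have hX0 : X ≠ 0 := by
      intro h0
      have : Φ X = 0 := by rw [h0, map_zero]
      rw [hX, LieEquiv.apply_symm_apply] at this
      simpa using congrFun (congrFun this i) j
    have hbr : ⁅Matrix.diagonal (Pi.single k (1 : K)), X⁆ = (d i - d j) • X := by
      apply Φ.injective
      change Φ _ = Φ _
      rw [LieEquiv.map_lie, hd, hX, map_smul, LieEquiv.apply_symm_apply, lie_diagonal_single]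
    obtain ⟨a, b, hab⟩ : ∃ a b, X a b ≠ 0 := by
      by_contra! hcon
      exact hX0 (by ext a b; exact hcon a b)
    have := congrFun (congrFun hbr a) b
    rw [lie_diagonal_apply, Matrix.smul_apply, smul_eq_mul] at this
    rw [← mul_right_cancel₀ hab this, Pi.single_apply, Pi.single_apply]
    split_ifs <;> simp
  have hsum : ∑ i, ∑ j, (d i - d j) * (d i - d j) = 2 * ((Fintype.card ι : K) - 1) := by
    rw [← killingForm_diagonal, ← hd, LieAlgebra.killingForm_of_equiv_apply, killingForm_diagonal,
      sum_sum_sub_mul_sub]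
    simp [Pi.single_apply]
  obtain ⟨p, ε, c, hε, h⟩ := exists_eq_const_add_single d hdiff hsum hcard
  exact ⟨p, ε, c, hε, by rw [hd, funext h]⟩

/-- The Lie algebra automorphism `A ↦ -Aᵀ` of the algebra of square matrices. -/
def negTranspose (ι K : Type*) [Fintype ι] [DecidableEq ι] [Field K] :
    Matrix ι ι K ≃ₗ⁅K⁆ Matrix ι ι K where
  toFun A := -Aᵀ
  map_add' A B := by rw [Matrix.transpose_add, neg_add]
  map_smul' c A := by simp
  map_lie' {A B} := by
    simp only [Ring.lie_def, Matrix.transpose_sub, Matrix.transpose_mul]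
    noncomm_ring
  invFun A := -Aᵀ
  left_inv A := by simp
  right_inv A := by simp

omit [CharZero K] in
theorem negTranspose_apply (A : Matrix ι ι K) : negTranspose ι K A = -Aᵀ := rfl

/-- A Lie automorphism of the matrix algebra that permutes the diagonal matrix units up to scalar
matrices sends each off-diagonal matrix unit to a multiple of a matrix unit. -/
theorem exists_map_single_eq_smul (Φ : Matrix ι ι K ≃ₗ⁅K⁆ Matrix ι ι K) (π : Equiv.Perm ι)
    (c : ι → K)
    (hΦ : ∀ k, Φ (Matrix.diagonal (Pi.single k 1)) =
      Matrix.diagonal fun i => c k + Pi.single (M := fun _ => K) (π k) 1 i)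
    {i j : ι} (hij : i ≠ j) :
    ∃ a : K, a ≠ 0 ∧ Φ (Matrix.single i j 1) = a • Matrix.single (π i) (π j) 1 := by
  set X := Φ (Matrix.single i j 1) with hX
  have hX0 : X ≠ 0 := by
    intro h0
    have := Φ.injective (h0.trans (map_zero Φ).symm)
    simpa using congrFun (congrFun this i) j
  -- An entry of `X` can be nonzero only where its weight under every diagonal matrix unit matches
  -- that of the unit at `(i, j)`; the units `k = i` and `k = j` already fix the position.
  have hkey : ∀ a b, X (π a) (π b) ≠ 0 → a = i ∧ b = j := by
    intro a b hab
    have h : ∀ k, (Pi.single (M := fun _ => K) k 1 a - Pi.single (M := fun _ => K) k 1 b : K) =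
        Pi.single (M := fun _ => K) k 1 i - Pi.single (M := fun _ => K) k 1 j := by
      intro k
      have h1 := congrArg Φ (lie_diagonal_single (Pi.single k (1 : K)) i j)
      rw [LieEquiv.map_lie, hΦ, map_smul] at h1
      have h2 := congrFun (congrFun h1 (π a)) (π b)
      rw [lie_diagonal_apply, Matrix.smul_apply, smul_eq_mul] at h2
      have h3 := mul_right_cancel₀ hab h2
      simpa [Pi.single_apply] using h3
    have hi := h i
    have hj := h j
    simp only [Pi.single_apply, hij, hij.symm, if_true, if_false] at hi hj
    constructor
    · by_contra hai
      simp only [hai, if_false] at hi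
      split_ifs at hi <;> norm_num at hi
    · by_contra hbj
      simp only [hbj, if_false] at hj
      split_ifs at hj <;> norm_num at hj
  have hXe : X = X (π i) (π j) • Matrix.single (π i) (π j) 1 := by
    ext a b
    rw [Matrix.smul_apply, smul_eq_mul]
    by_cases h : π i = a ∧ π j = b
    · simp [h.1, h.2]
    · rw [Matrix.single_apply_of_ne _ _ _ _ _ h, mul_zero]
      by_contra hne
      have := hkey (π.symm a) (π.symm b) (by simpa using hne)
      apply h
      rw [← this.1, ← this.2]
      simp
  refine ⟨_, fun h0 => hX0 ?_, hXe⟩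
  rw [hXe, h0, zero_smul]

/-- A Lie automorphism of the matrix algebra that permutes the diagonal matrix units up to scalar
matrices is a conjugation on the traceless matrices. -/
theorem exists_conj_of_map_diagonal_single (Φ : Matrix ι ι K ≃ₗ⁅K⁆ Matrix ι ι K) (π : Equiv.Perm ι)
    (c : ι → K)
    (hΦ : ∀ k, Φ (Matrix.diagonal (Pi.single k 1)) =
      Matrix.diagonal fun i => c k + Pi.single (M := fun _ => K) (π k) 1 i)
    (hcard : 3 ≤ Fintype.card ι) :
    ∃ G : GL ι K, ∀ A : Matrix ι ι K, A.trace = 0 → Φ A * G.val = G.val * A := by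
  -- The value 1 on the diagonal is a filler that makes the choice total.
  have hex : ∀ i j, ∃ a : K, a ≠ 0 ∧
      (i ≠ j → Φ (Matrix.single i j 1) = a • Matrix.single (π i) (π j) 1) := by
    intro i j
    by_cases h : i = j
    · exact ⟨1, one_ne_zero, fun h' => absurd h h'⟩
    · obtain ⟨a, ha, h'⟩ := exists_map_single_eq_smul Φ π c hΦ h
      exact ⟨a, ha, fun _ => h'⟩
  choose a ha hmap using hex
  have hmul : ∀ i j k, i ≠ j → j ≠ k → i ≠ k → a i j * a j k = a i k := by
    intro i j k hij hjk hik
    have h1 : ⁅Matrix.single i j (1 : K), Matrix.single j k (1 : K)⁆ = Matrix.single i k 1 := by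
      rw [Ring.lie_def, Matrix.single_mul_single_same, Matrix.single_mul_single_of_ne _ _ _ _ hik.symm]
      simp
    have h2 := congrArg Φ h1
    rw [LieEquiv.map_lie, hmap i j hij, hmap j k hjk, hmap i k hik, smul_lie, lie_smul,
      Ring.lie_def, Matrix.single_mul_single_same,
      Matrix.single_mul_single_of_ne _ _ _ _ (π.injective.ne hik.symm)] at h2
    simpa using congrFun (congrFun h2 (π i)) (π k)
  have hinv : ∀ i j, i ≠ j → a i j * a j i = 1 ∧ c i = c j := by
    intro i j hij
    have h1 : ⁅Matrix.single i j (1 : K), Matrix.single j i (1 : K)⁆ =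
        Matrix.diagonal (Pi.single i 1) - Matrix.diagonal (Pi.single j 1) := by
      rw [Ring.lie_def, Matrix.single_mul_single_same, Matrix.single_mul_single_same,
        Matrix.diagonal_single, Matrix.diagonal_single]
      simp
    have h2 := congrArg Φ h1
    rw [LieEquiv.map_lie, hmap i j hij, hmap j i hij.symm, map_sub, hΦ, hΦ, smul_lie, lie_smul,
      Ring.lie_def, Matrix.single_mul_single_same, Matrix.single_mul_single_same] at h2
    -- A third index exists as `n ≥ 3`; the diagonal entry at `π k` sees only the scalar part `c i -
    -- c j`.
    obtain ⟨k, hk⟩ : ∃ k, k ∉ ({i, j} : Finset ι) := by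
      by_contra! hcon
      have := Finset.card_le_card (fun x _ => hcon x : (Finset.univ : Finset ι) ⊆ {i, j})
      have := Finset.card_le_two (a := i) (b := j)
      rw [Finset.card_univ] at *
      omega
    simp only [Finset.mem_insert, Finset.mem_singleton, not_or] at hk
    have hc : c i = c j := by
      have := congrFun (congrFun h2 (π k)) (π k)
      simp [Pi.single_apply, hk.1, hk.2, Ne.symm hk.1, Ne.symm hk.2] at this
      linear_combination -this
    refine ⟨?_, hc⟩
    have := congrFun (congrFun h2 (π i)) (π i)
    simp [Pi.single_apply, hij, hij.symm] at this
    linear_combination this + hc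
  obtain ⟨o⟩ : Nonempty ι := Fintype.card_pos_iff.1 (by omega)
  -- The relations on `a` say that it is a multiplicative coboundary, `a i j = g i / g j`. Fixing
  -- the base point `o`, one takes the column `a i o`, normalised by `g o = 1`.
  set g : ι → K := fun i => if i = o then 1 else a i o with hg
  have hg0 : ∀ i, g i ≠ 0 := by
    intro i
    simp only [hg]
    split_ifs
    · exact one_ne_zero
    · exact ha i o
  have hga : ∀ i j, i ≠ j → a i j * g j = g i := by
    intro i j hij
    by_cases hj : j = o
    · subst hj
      simp [hg, hij]
    · by_cases hi : i = o
      · subst hi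
        simp [hg, hij.symm, (hinv i j hij).1]
      · simp [hg, hi, hj, hmul i j o hij hj hi]
  -- The monomial matrix sending the `i`-th basis vector to `g i` times the `π i`-th.
  have hGu : IsUnit ((Matrix.diagonal g).submatrix π.symm (Equiv.refl ι)) := by
    rw [Matrix.isUnit_submatrix_equiv, Matrix.isUnit_diagonal, Pi.isUnit_iff]
    exact fun i => (hg0 i).isUnit
  obtain ⟨G, hG⟩ := hGu
  have hGapp : ∀ x i, G.val x i = if x = π i then g i else 0 := by
    intro x i
    rw [hG]
    simp only [Matrix.submatrix_apply, Equiv.refl_apply, Matrix.diagonal_apply]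
    by_cases h : x = π i
    · simp [h]
    · rw [if_neg h, if_neg fun h' => h (by rw [← h', Equiv.apply_symm_apply])]
  have hGl : ∀ i j, G.val * Matrix.single i j 1 = g i • Matrix.single (π i) j 1 := by
    intro i j
    ext x y
    simp only [Matrix.mul_apply, Matrix.single_apply, hGapp, Matrix.smul_apply, smul_eq_mul]
    by_cases hy : j = y <;> by_cases hx : x = π i <;> simp [hx, hy, eq_comm]
  have hGr : ∀ i j, Matrix.single (π i) (π j) 1 * G.val = g j • Matrix.single (π i) j 1 := by
    intro i j
    ext x y
    simp only [Matrix.mul_apply, Matrix.single_apply, hGapp, Matrix.smul_apply, smul_eq_mul]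
    by_cases hx : π i = x <;> by_cases hy : j = y <;> simp [hx, hy]
  have hmain : ∀ A : Matrix ι ι K, Φ A * G.val = G.val * A + (c o * A.trace) • G.val := by
    intro A
    have hlin : (LinearMap.mulRight K G.val) ∘ₗ (Φ : Matrix ι ι K →ₗ[K] Matrix ι ι K) =
        LinearMap.mulLeft K G.val + (c o • Matrix.traceLinearMap ι K K).smulRight G.val := by
      refine (Matrix.stdBasis K ι ι).ext fun ⟨i, j⟩ => ?_
      rw [Matrix.stdBasis_eq_single]
      simp only [LinearMap.comp_apply, LinearMap.mulRight_apply, LinearMap.add_apply,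
        LinearMap.mulLeft_apply, LinearMap.smulRight_apply, LinearMap.smul_apply,
        Matrix.traceLinearMap_apply, smul_eq_mul]
      change Φ (Matrix.single i j 1) * G.val = _
      by_cases hij : i = j
      · subst hij
        have hco : c i = c o := by
          by_cases h : i = o
          · rw [h]
          · exact (hinv i o h).2
        rw [← Matrix.diagonal_single, hΦ, Matrix.diagonal_single, Matrix.trace_single_eq_same, hGl]
        have : (Matrix.diagonal fun x => c i + Pi.single (M := fun _ => K) (π i) 1 x) =
            c i • (1 : Matrix ι ι K) + Matrix.single (π i) (π i) 1 := by
          rw [← Matrix.diagonal_single, Matrix.smul_one_eq_diagonal, Matrix.diagonal_add]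
        rw [this, add_mul, hGr, hco, Matrix.smul_mul, one_mul, mul_one, add_comm]
      · rw [hmap i j hij, Matrix.smul_mul, hGr, hGl, Matrix.trace_single_eq_of_ne _ _ _ hij,
          smul_smul, hga i j hij]
        simp
    exact LinearMap.congr_fun hlin A
  exact ⟨G, fun A hA => by rw [hmain, hA]; simp⟩

/-- A Lie automorphism of the matrix algebra that preserves the diagonal matrices acts on the
traceless matrices as a conjugation or as a conjugation composed with `A ↦ -Aᵀ`. -/
theorem exists_conj_of_map_diagonal (Φ : Matrix ι ι K ≃ₗ⁅K⁆ Matrix ι ι K)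
    (hΦ : ∀ d : ι → K, ∃ e : ι → K, Φ (Matrix.diagonal d) = Matrix.diagonal e)
    (hcard : 3 ≤ Fintype.card ι) :
    ∃ G : GL ι K, (∀ A : Matrix ι ι K, A.trace = 0 → Φ A * G.val = G.val * A) ∨
      (∀ A : Matrix ι ι K, A.trace = 0 → Φ A * G.val = G.val * -Aᵀ) := by
  choose p ε c hε hp using exists_diagonal_single_image Φ hΦ (by omega)
  -- The Killing form of two distinct diagonal matrix units is `-2`, compared here with that of
  -- their images.
  have hkill : ∀ k l, k ≠ l →
      ε k * ε l * (Fintype.card ι * Pi.single (M := fun _ => K) (p l) 1 (p k) - 1) = -1 := by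
    intro k l hkl
    have h := LieAlgebra.killingForm_of_equiv_apply Φ (Matrix.diagonal (Pi.single k 1))
      (Matrix.diagonal (Pi.single l 1))
    rw [hp, hp, killingForm_diagonal, killingForm_diagonal] at h
    simp only [add_sub_add_left_eq_sub] at h
    rw [sum_sum_sub_mul_sub, sum_sum_sub_mul_sub] at h
    by_cases hpp : p k = p l
    · simp only [Pi.single_apply, hpp, mul_ite, mul_one, mul_zero, ite_mul, zero_mul,
        Finset.sum_ite_eq', Finset.mem_univ, if_true, if_neg hkl.symm, zero_sub] at h ⊢
      linear_combination h / 2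
    · simp only [Pi.single_apply, hpp, Ne.symm hpp, mul_ite, mul_one, mul_zero, ite_mul, zero_mul,
        Finset.sum_ite_eq', Finset.mem_univ, if_true, if_neg hkl.symm, if_false, zero_sub] at h ⊢
      linear_combination h / 2
  have hεε : ∀ k l, k ≠ l → p k ≠ p l ∧ ε k = ε l := by
    intro k l hkl
    have h := hkill k l hkl
    have hn0 : (Fintype.card ι : K) ≠ 0 := by exact_mod_cast (by omega : Fintype.card ι ≠ 0)
    have hn2 : (Fintype.card ι : K) ≠ 2 := by exact_mod_cast (by omega : Fintype.card ι ≠ 2)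
    -- Coinciding indices would give `±(n - 1) = -1`, so `n = 0` or `n = 2`; distinct indices give
    -- `ε k * ε l = 1`.
    by_cases hpp : p k = p l
    · exfalso
      rw [hpp, Pi.single_eq_same] at h
      rcases hε k with h1 | h1 <;> rcases hε l with h2 | h2 <;> rw [h1, h2] at h
      · exact hn0 (by linear_combination h)
      · exact hn2 (by linear_combination -h)
      · exact hn2 (by linear_combination -h)
      · exact hn0 (by linear_combination h)
    · refine ⟨hpp, ?_⟩
      rw [Pi.single_eq_of_ne hpp] at h
      rcases hε k with h1 | h1 <;> rcases hε l with h2 | h2 <;> rw [h1, h2] at h ⊢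
      · norm_num at h
      · norm_num at h
  have hinj : Function.Injective p := fun k l h => by
    by_contra hkl
    exact (hεε k l hkl).1 h
  let π := Equiv.ofBijective p (Finite.injective_iff_bijective.1 hinj)
  obtain ⟨o⟩ : Nonempty ι := Fintype.card_pos_iff.1 (by omega)
  have hεo : ∀ k, ε k = ε o := fun k => by
    by_cases h : k = o
    · rw [h]
    · exact (hεε k o h).2
  rcases hε o with ho | ho
  · obtain ⟨G, hG⟩ := exists_conj_of_map_diagonal_single Φ π c
      (fun k => by rw [hp, hεo, ho]; simp [π]) hcard
    exact ⟨G, Or.inl hG⟩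
  -- Precomposing with `A ↦ -Aᵀ` negates the images of the diagonal units, which reduces sign `-1`
  -- to sign `+1` with constants `-c`.
  · obtain ⟨G, hG⟩ := exists_conj_of_map_diagonal_single ((negTranspose ι K).trans Φ) π (-c)
      (fun k => by
        rw [LieEquiv.trans_apply, negTranspose_apply, Matrix.diagonal_transpose, map_neg, hp, hεo,
          ho, Matrix.diagonal_neg]
        congr 1
        funext i
        simp [π, add_comm]) hcard
    refine ⟨G, Or.inr fun A hA => ?_⟩
    rw [← hG (-Aᵀ) (by simp [hA]), LieEquiv.trans_apply, negTranspose_apply]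
    simp

end Classification

/-! ### Automorphisms of `sl_n` and their extension to all matrices -/

section SpecialLinear

variable {n : ℕ}

theorem trace_coe (A : SL n) : Matrix.trace (A : Matrix (Fin n) (Fin n) ℂ) = 0 := A.2

theorem mem_SL {A : Matrix (Fin n) (Fin n) ℂ} : A ∈ SL n ↔ A.trace = 0 := Iff.rfl

/-- The traceless part of a matrix. -/
def tracelessPart (n : ℕ) [NeZero n] : Matrix (Fin n) (Fin n) ℂ →ₗ[ℂ] SL n where
  toFun A := ⟨A - (A.trace / n) • 1, by
    rw [mem_SL]
    have : (n : ℂ) ≠ 0 := NeZero.ne _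
    simp [this]⟩
  map_add' A B := by
    ext1
    change _ = A - (A.trace / n) • 1 + (B - (B.trace / n) • 1)
    simp only [Matrix.trace_add, add_div, add_smul]
    abel
  map_smul' c A := by
    ext1
    simp [mul_div_assoc, mul_smul, smul_sub]

theorem coe_tracelessPart [NeZero n] (A : Matrix (Fin n) (Fin n) ℂ) :
    (tracelessPart n A : Matrix (Fin n) (Fin n) ℂ) = A - (A.trace / n) • 1 := rfl

theorem tracelessPart_coe [NeZero n] (A : SL n) :
    tracelessPart n (A : Matrix (Fin n) (Fin n) ℂ) = A := by
  ext1
  rw [coe_tracelessPart, trace_coe]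
  simp

theorem tracelessPart_one [NeZero n] : tracelessPart n 1 = 0 := by
  ext1
  have : (n : ℂ) ≠ 0 := NeZero.ne _
  simp [coe_tracelessPart, this]

theorem tracelessPart_lie [NeZero n] (A B : Matrix (Fin n) (Fin n) ℂ) :
    tracelessPart n ⁅A, B⁆ = ⁅tracelessPart n A, tracelessPart n B⁆ := by
  ext1
  rw [LieSubalgebra.coe_bracket, coe_tracelessPart, coe_tracelessPart, coe_tracelessPart,
    LieAlgebra.matrix_trace_commutator_zero]
  simp only [Ring.lie_def, zero_div, zero_smul, sub_zero, sub_mul, mul_sub, Matrix.smul_mul,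
    Matrix.mul_smul, one_mul, mul_one, smul_comm (B.trace / (n : ℂ)) (A.trace / (n : ℂ))]
  abel

/-- The extension of an endomorphism of the traceless matrices by the identity on scalars. -/
def extendLinear [NeZero n] (φ : SL n →ₗ[ℂ] SL n) :
    Matrix (Fin n) (Fin n) ℂ →ₗ[ℂ] Matrix (Fin n) (Fin n) ℂ :=
  (SL n).subtype ∘ₗ φ ∘ₗ tracelessPart n +
    ((n : ℂ)⁻¹ • Matrix.traceLinearMap (Fin n) ℂ ℂ).smulRight 1

theorem extendLinear_apply [NeZero n] (φ : SL n →ₗ[ℂ] SL n) (A : Matrix (Fin n) (Fin n) ℂ) :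
    extendLinear φ A = φ (tracelessPart n A) + (A.trace / n) • 1 := by
  simp [extendLinear, div_eq_inv_mul]

theorem extendLinear_extendLinear [NeZero n] (φ ψ : SL n →ₗ[ℂ] SL n)
    (h : ∀ A, φ (ψ A) = A) (A : Matrix (Fin n) (Fin n) ℂ) :
    extendLinear φ (extendLinear ψ A) = A := by
  have hn : (n : ℂ) ≠ 0 := NeZero.ne _
  have h1 : tracelessPart n (extendLinear ψ A) = ψ (tracelessPart n A) := by
    rw [extendLinear_apply, map_add, map_smul, tracelessPart_one, tracelessPart_coe, smul_zero,
      add_zero]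
  have h2 : (extendLinear ψ A).trace = A.trace := by
    rw [extendLinear_apply, Matrix.trace_add, trace_coe]
    simp [hn]
  rw [extendLinear_apply, h1, h, h2, coe_tracelessPart, sub_add_cancel]

/-- The extension of an automorphism of `sl_n(ℂ)` to all matrices by the identity on scalars. -/
def extend [NeZero n] (φ : SL n ≃ₗ⁅ℂ⁆ SL n) :
    Matrix (Fin n) (Fin n) ℂ ≃ₗ⁅ℂ⁆ Matrix (Fin n) (Fin n) ℂ where
  __ := extendLinear (φ : SL n →ₗ[ℂ] SL n)
  invFun := extendLinear (φ.symm : SL n →ₗ[ℂ] SL n)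
  left_inv := extendLinear_extendLinear _ _ φ.symm_apply_apply
  right_inv := extendLinear_extendLinear _ _ φ.apply_symm_apply
  map_lie' {A B} := by
    change extendLinear _ _ = ⁅extendLinear _ _, extendLinear _ _⁆
    simp only [extendLinear_apply]
    rw [tracelessPart_lie]
    change ((φ ⁅_, _⁆ : SL n) : Matrix (Fin n) (Fin n) ℂ) + _ =
      ⁅((φ _ : SL n) : Matrix (Fin n) (Fin n) ℂ) + _, ((φ _ : SL n) : Matrix (Fin n) (Fin n) ℂ) + _⁆
    rw [LieEquiv.map_lie, LieAlgebra.matrix_trace_commutator_zero, LieSubalgebra.coe_bracket]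
    simp only [Ring.lie_def, zero_div, zero_smul, add_zero, add_mul, mul_add, Matrix.smul_mul,
      Matrix.mul_smul, one_mul, mul_one, smul_comm (B.trace / (n : ℂ)) (A.trace / (n : ℂ))]
    abel

theorem extend_apply [NeZero n] (φ : SL n ≃ₗ⁅ℂ⁆ SL n) (A : Matrix (Fin n) (Fin n) ℂ) :
    extend φ A = φ (tracelessPart n A) + (A.trace / n) • 1 :=
  extendLinear_apply _ _

theorem extend_coe [NeZero n] (φ : SL n ≃ₗ⁅ℂ⁆ SL n) (A : SL n) :
    extend φ (A : Matrix (Fin n) (Fin n) ℂ) = φ A := by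
  rw [extend_apply, tracelessPart_coe, trace_coe]
  simp

/-- Conjugation by an invertible matrix as an automorphism of `sl_n(ℂ)`. -/
def conjAut : GL (Fin n) ℂ →* (SL n ≃ₗ⁅ℂ⁆ SL n) where
  toFun g :=
    { toFun := fun A => ⟨g.val * A.val * g⁻¹.val, by
        rw [mem_SL, Matrix.trace_mul_comm, ← mul_assoc, ← Units.val_mul, inv_mul_cancel, Units.val_one,
          one_mul, trace_coe]⟩
      invFun := fun A => ⟨g⁻¹.val * A.val * g.val, by
        rw [mem_SL, Matrix.trace_mul_comm, ← mul_assoc, ← Units.val_mul, mul_inv_cancel, Units.val_one,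
          one_mul, trace_coe]⟩
      map_add' := fun A B => by ext1; simp [mul_add, add_mul]
      map_smul' := fun c A => by ext1; simp
      map_lie' := fun {A B} => by
        ext1
        simp only [LieSubalgebra.coe_bracket, Ring.lie_def, mul_sub, sub_mul, mul_assoc,
          Units.inv_mul_cancel_left]
      left_inv := fun A => by ext1; simp [mul_assoc]
      right_inv := fun A => by ext1; simp [mul_assoc] }
  map_one' := by
    refine LieEquiv.ext fun A => ?_
    ext1
    change (1 : GL (Fin n) ℂ).val * A.val * (1 : GL (Fin n) ℂ)⁻¹.val = A.val
    simp
  map_mul' g h := by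
    refine LieEquiv.ext fun A => ?_
    ext1
    change (g * h).val * A.val * (g * h)⁻¹.val = g.val * (h.val * A.val * h⁻¹.val) * g⁻¹.val
    simp only [mul_inv_rev, Units.val_mul, mul_assoc]

theorem coe_conjAut (g : GL (Fin n) ℂ) (A : SL n) :
    (conjAut g A : Matrix (Fin n) (Fin n) ℂ) = g.val * A.val * g⁻¹.val := rfl

theorem eq_conjAut_iff {g : GL (Fin n) ℂ} {A B : SL n} :
    B = conjAut g A ↔ B.val * g.val = g.val * A.val := by
  rw [Subtype.ext_iff, coe_conjAut, Units.eq_mul_inv_iff_mul_eq]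

/-- The automorphism `A ↦ -Aᵀ` of `sl_n(ℂ)`. -/
def negTransposeAut (n : ℕ) : SL n ≃ₗ⁅ℂ⁆ SL n where
  toFun A := ⟨-A.valᵀ, by
    rw [mem_SL, Matrix.trace_neg, Matrix.trace_transpose, trace_coe, neg_zero]⟩
  invFun A := ⟨-A.valᵀ, by
    rw [mem_SL, Matrix.trace_neg, Matrix.trace_transpose, trace_coe, neg_zero]⟩
  map_add' A B := Subtype.ext (map_add (negTranspose (Fin n) ℂ) A.val B.val)
  map_smul' c A := Subtype.ext (map_smul (negTranspose (Fin n) ℂ) c A.val)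
  map_lie' {A B} := Subtype.ext ((negTranspose (Fin n) ℂ).map_lie A.val B.val)
  left_inv A := Subtype.ext ((negTranspose (Fin n) ℂ).symm_apply_apply A.val)
  right_inv A := Subtype.ext ((negTranspose (Fin n) ℂ).apply_symm_apply A.val)

theorem coe_negTransposeAut (A : SL n) :
    (negTransposeAut n A : Matrix (Fin n) (Fin n) ℂ) = -A.valᵀ := rfl

/-- Transposing turns conjugation by `g` into conjugation by the inverse transpose of `g`, and the
hypothesis says that `h` is a scalar multiple of the latter. -/
theorem negTransposeAut_mul_conjAut {g h : GL (Fin n) ℂ} {c : ℂ}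
    (hgh : h.valᵀ * g.val = c • 1) :
    negTransposeAut n * conjAut g = conjAut h * negTransposeAut n := by
  refine LieEquiv.ext fun A => ?_
  change negTransposeAut n (conjAut g A) = conjAut h (negTransposeAut n A)
  rw [eq_conjAut_iff, coe_negTransposeAut, coe_negTransposeAut, coe_conjAut, neg_mul, mul_neg,
    neg_inj]
  apply Matrix.transpose_injective
  have h1 : h.valᵀ = c • g⁻¹.val := by
    rw [← Units.mul_inv_cancel_right h.valᵀ g, hgh, Matrix.smul_mul, one_mul]
  rw [Matrix.transpose_mul, Matrix.transpose_transpose, Matrix.transpose_mul h.val,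
    Matrix.transpose_transpose, h1, mul_assoc g.val, Matrix.smul_mul, Units.inv_mul_cancel_left,
    Matrix.mul_smul]

/-- An automorphism of `sl_n(ℂ)` that sends the subalgebra diagonalised by `U` into the one
diagonalised by `V` is a conjugation or a conjugation composed with `A ↦ -Aᵀ`. -/
theorem exists_eq_conjAut (hn : 3 ≤ n) (φ : SL n ≃ₗ⁅ℂ⁆ SL n) (U V : GL (Fin n) ℂ)
    (hφ : ∀ A : SL n, (∃ d, A.val * U.val = U.val * Matrix.diagonal d) →
      ∃ e, (φ A).val * V.val = V.val * Matrix.diagonal e) :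
    ∃ g : GL (Fin n) ℂ, φ = conjAut g ∨ φ = conjAut g * negTransposeAut n := by
  have : NeZero n := ⟨by omega⟩
  set φ' := conjAut V⁻¹ * φ * conjAut U with hφ'
  have hdiag : ∀ d, ∃ e, extend φ' (Matrix.diagonal d) = Matrix.diagonal e := by
    intro d
    obtain ⟨d', hd'⟩ : ∃ d', (tracelessPart n (Matrix.diagonal d)).val = Matrix.diagonal d' :=
      ⟨_, by rw [coe_tracelessPart, Matrix.smul_one_eq_diagonal, Matrix.diagonal_sub]⟩
    obtain ⟨e, he⟩ := hφ (conjAut U (tracelessPart n (Matrix.diagonal d))) ⟨d', by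
      rw [← hd', ← eq_conjAut_iff]⟩
    have h1 : (φ' (tracelessPart n (Matrix.diagonal d))).val = Matrix.diagonal e := by
      change V⁻¹.val * (φ (conjAut U (tracelessPart n (Matrix.diagonal d)))).val * V⁻¹⁻¹.val = _
      rw [inv_inv, mul_assoc, he, Units.inv_mul_cancel_left]
    exact ⟨_, by rw [extend_apply, h1, Matrix.smul_one_eq_diagonal, Matrix.diagonal_add]⟩
  have hφeq : φ = conjAut V * φ' * conjAut U⁻¹ := by
    rw [hφ', map_inv, map_inv]
    group
  obtain ⟨G, hG | hG⟩ := exists_conj_of_map_diagonal (extend φ') hdiag (by simpa using hn)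
  · have h1 : φ' = conjAut G := LieEquiv.ext fun A => by
      rw [eq_conjAut_iff, ← extend_coe]
      exact hG _ (trace_coe A)
    exact ⟨V * G * U⁻¹, Or.inl (by rw [hφeq, h1, map_mul, map_mul])⟩
  · have h1 : φ' = conjAut G * negTransposeAut n := LieEquiv.ext fun A => by
      change _ = conjAut G (negTransposeAut n A)
      rw [eq_conjAut_iff, ← extend_coe]
      exact hG _ (trace_coe A)
    -- The inverse transpose of `U⁻¹`, which moves `conjAut U⁻¹` to the left of `negTransposeAut n`.
    let h : GL (Fin n) ℂ := ⟨U.valᵀ, U⁻¹.valᵀ,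
      by rw [← Matrix.transpose_mul, Units.inv_mul, Matrix.transpose_one],
      by rw [← Matrix.transpose_mul, Units.mul_inv, Matrix.transpose_one]⟩
    have hh : h.valᵀ * U⁻¹.val = (1 : ℂ) • 1 := by
      rw [Matrix.transpose_transpose, Units.mul_inv, one_smul]
    refine ⟨V * G * h, Or.inr ?_⟩
    rw [hφeq, h1, map_mul, map_mul, mul_assoc, mul_assoc (conjAut G),
      negTransposeAut_mul_conjAut hh]
    simp only [mul_assoc]

end SpecialLinear

/-! ### Eigenlines: the duality between Cartan subalgebras and orthoframes -/

section Lines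

variable {n : ℕ}

/-- The projective transformation of the set of 1-spaces given by an invertible matrix. -/
def projHom : GL (Fin n) ℂ →* Equiv.Perm (ℙ ℂ (Fin n → ℂ)) :=
  (MulAction.toPermHom PGL(n, ℂ) (ℙ ℂ (Fin n → ℂ))).comp Matrix.ProjGenLinGroup.mk

theorem mulVec_ne_zero (g : GL (Fin n) ℂ) {v : Fin n → ℂ} (hv : v ≠ 0) : g.val *ᵥ v ≠ 0 := by
  intro h
  apply hv
  rw [← Matrix.one_mulVec v, ← Units.inv_mul g, ← Matrix.mulVec_mulVec, h, Matrix.mulVec_zero]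

theorem projHom_mk (g : GL (Fin n) ℂ) {v : Fin n → ℂ} (hv : v ≠ 0) :
    projHom g (Projectivization.mk ℂ v hv) =
      Projectivization.mk ℂ (g.val *ᵥ v) (mulVec_ne_zero g hv) := rfl

theorem conj_mk {v : Fin n → ℂ} (hv : v ≠ 0) :
    conj n (Projectivization.mk ℂ v hv) = Projectivization.mk ℂ (star v) (star_ne_zero.2 hv) := rfl

/-- The 1-space `ℓ` consists of eigenvectors of the matrix `A`. -/
def IsEigenline (A : Matrix (Fin n) (Fin n) ℂ) (ℓ : ℙ ℂ (Fin n → ℂ)) : Prop :=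
  ∃ c : ℂ, A *ᵥ ℓ.rep = c • ℓ.rep

theorem isEigenline_mk {A : Matrix (Fin n) (Fin n) ℂ} {v : Fin n → ℂ} (hv : v ≠ 0) :
    IsEigenline A (Projectivization.mk ℂ v hv) ↔ ∃ c : ℂ, A *ᵥ v = c • v := by
  obtain ⟨a, ha⟩ := Projectivization.exists_smul_eq_mk_rep ℂ v hv
  rw [IsEigenline, ← ha, Units.smul_def]
  refine exists_congr fun c => ?_
  rw [Matrix.mulVec_smul, smul_comm c]
  exact smul_right_injective _ a.ne_zero |>.eq_iff

theorem isEigenline_conjAut (g : GL (Fin n) ℂ) (A : SL n) (ℓ : ℙ ℂ (Fin n → ℂ)) :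
    IsEigenline (conjAut g A).val (projHom g ℓ) ↔ IsEigenline A.val ℓ := by
  induction ℓ using Projectivization.ind with
  | _ v hv =>
    rw [projHom_mk, isEigenline_mk, isEigenline_mk, coe_conjAut]
    refine exists_congr fun c => ?_
    rw [Matrix.mulVec_mulVec, mul_assoc, mul_assoc, Units.inv_mul, mul_one, ← Matrix.mulVec_mulVec,
      ← Matrix.mulVec_smul]
    exact (Matrix.mulVec_injective_of_isUnit g.isUnit).eq_iff

/-- Entrywise complex conjugation of traceless matrices. -/
def conjEquiv (n : ℕ) : SL n ≃ SL n :=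
  Function.Involutive.toPerm
    (fun A => ⟨A.val.map star, by
      rw [mem_SL, ← Matrix.transpose_transpose (A.val.map star), Matrix.trace_transpose]
      exact trace_coe (adjoint A)⟩)
    (fun A => by ext; simp)

theorem coe_conjEquiv (A : SL n) : (conjEquiv n A).val = A.val.map star := rfl

theorem map_star_mulVec (A : Matrix (Fin n) (Fin n) ℂ) (v : Fin n → ℂ) :
    A.map star *ᵥ star v = star (A *ᵥ v) := by
  ext i
  simp [Matrix.mulVec, dotProduct]

theorem isEigenline_conjEquiv (A : SL n) (ℓ : ℙ ℂ (Fin n → ℂ)) :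
    IsEigenline (conjEquiv n A).val (conj n ℓ) ↔ IsEigenline A.val ℓ := by
  induction ℓ using Projectivization.ind with
  | _ v hv =>
    rw [conj_mk, isEigenline_mk, isEigenline_mk, coe_conjEquiv, map_star_mulVec]
    constructor
    · rintro ⟨c, hc⟩
      exact ⟨star c, star_injective (by rw [hc, star_smul, star_star])⟩
    · rintro ⟨c, hc⟩
      exact ⟨star c, by rw [hc, star_smul]⟩

/-- If sets of matrices and sets of 1-spaces determine each other by the eigenline relation, then
transformations compatible with this relation match them up in the same way. -/
theorem image_eq_iff {H H' : Set (SL n)} {O O' : Set (ℙ ℂ (Fin n → ℂ))}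
    (hH : ∀ A, A ∈ H ↔ ∀ ℓ ∈ O, IsEigenline A.val ℓ)
    (hO : ∀ ℓ, ℓ ∈ O ↔ ∀ A ∈ H, IsEigenline A.val ℓ)
    (hH' : ∀ A, A ∈ H' ↔ ∀ ℓ ∈ O', IsEigenline A.val ℓ)
    (hO' : ∀ ℓ, ℓ ∈ O' ↔ ∀ A ∈ H', IsEigenline A.val ℓ)
    (f : SL n ≃ SL n) (ψ : Equiv.Perm (ℙ ℂ (Fin n → ℂ)))
    (hf : ∀ A ℓ, IsEigenline (f A).val (ψ ℓ) ↔ IsEigenline A.val ℓ) :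
    f '' H = H' ↔ ψ '' O = O' := by
  constructor
  · rintro rfl
    ext ℓ
    obtain ⟨ℓ, rfl⟩ := ψ.surjective ℓ
    rw [ψ.injective.mem_set_image, hO, hO', Set.forall_mem_image]
    simp only [hf]
  · rintro rfl
    ext A
    obtain ⟨A, rfl⟩ := f.surjective A
    rw [f.injective.mem_set_image, hH, hH', Set.forall_mem_image]
    simp only [hf]

/-- The matrix whose columns are the vectors of an orthonormal basis. -/
def basisGL (b : OrthonormalBasis (Fin n) ℂ (EuclideanSpace ℂ (Fin n))) : GL (Fin n) ℂ :=
  have h : (Matrix.of fun i k => (b k).ofLp i)ᴴ * (Matrix.of fun i k => (b k).ofLp i) = 1 := by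
    ext k l
    rw [Matrix.one_apply, ← orthonormal_iff_ite.1 b.orthonormal k l,
      EuclideanSpace.inner_eq_star_dotProduct, Matrix.mul_apply, dotProduct]
    exact Finset.sum_congr rfl fun i _ => mul_comm _ _
  ⟨Matrix.of fun i k => (b k).ofLp i, (Matrix.of fun i k => (b k).ofLp i)ᴴ,
    mul_eq_one_comm.1 h, h⟩

variable (b : OrthonormalBasis (Fin n) ℂ (EuclideanSpace ℂ (Fin n)))

theorem basisGL_apply (i k : Fin n) : (basisGL b).val i k = (b k).ofLp i := rfl

theorem conjTranspose_basisGL_mul : (basisGL b).valᴴ * (basisGL b).val = 1 :=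
  (basisGL b).inv_mul

theorem isEigenline_line {A : Matrix (Fin n) (Fin n) ℂ} {k : Fin n} :
    IsEigenline A (line b k) ↔ ∃ c : ℂ, A *ᵥ (b k).ofLp = c • (b k).ofLp :=
  isEigenline_mk _

theorem exists_mul_basisGL_eq_iff {A : Matrix (Fin n) (Fin n) ℂ} :
    (∃ d, A * (basisGL b).val = (basisGL b).val * Matrix.diagonal d) ↔
      ∀ ℓ ∈ Ort b, IsEigenline A ℓ := by
  rw [Ort, Set.forall_mem_range]
  simp only [isEigenline_line]
  rw [Classical.skolem]
  refine exists_congr fun d => ?_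
  constructor
  · intro h k
    ext i
    have := congrFun (congrFun h i) k
    rw [Matrix.mul_diagonal] at this
    rw [Pi.smul_apply, smul_eq_mul, mul_comm]
    exact this
  · intro h
    ext i k
    have := congrFun (h k) i
    rw [Matrix.mul_diagonal, mul_comm]
    exact this

theorem line_injective : Function.Injective (line b) := by
  intro k l h
  by_contra hkl
  obtain ⟨a, ha⟩ := (Projectivization.mk_eq_mk_iff' ℂ _ _ _ _).1 h
  have h1 : b k = a • b l := by
    ext i
    exact (congrFun ha i).symm
  have h2 := orthonormal_iff_ite.1 b.orthonormal l k
  rw [if_neg (Ne.symm hkl), h1, inner_smul_right, orthonormal_iff_ite.1 b.orthonormal l l,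
    if_pos rfl, mul_one] at h2
  rw [h2, zero_smul] at h1
  exact b.orthonormal.ne_zero k h1

/-- The lines of an orthoframe are the common eigenlines of the traceless matrices that are diagonal
with respect to the corresponding basis. -/
theorem mem_Ort_of_forall_isEigenline {ℓ : ℙ ℂ (Fin n → ℂ)}
    (h : ∀ A : SL n, (∀ ℓ ∈ Ort b, IsEigenline A.val ℓ) → IsEigenline A.val ℓ) : ℓ ∈ Ort b := by
  set U := basisGL b with hU
  have hdiag : ∀ k l, IsEigenline (LieAlgebra.SpecialLinear.singleSubSingle k l (1 : ℂ)).val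
      (projHom U⁻¹ ℓ) := by
    intro k l
    rw [← isEigenline_conjAut U, ← Equiv.Perm.mul_apply, ← map_mul, mul_inv_cancel, map_one projHom,
      Equiv.Perm.one_apply]
    refine h _ ((exists_mul_basisGL_eq_iff b).1 ⟨Pi.single k 1 - Pi.single l 1, ?_⟩)
    rw [eq_conjAut_iff.1 rfl, LieAlgebra.SpecialLinear.val_singleSubSingle, ← Matrix.diagonal_single,
      ← Matrix.diagonal_single, Matrix.diagonal_sub]
    rfl
  have hℓ : ℓ = projHom U (projHom U⁻¹ ℓ) := by
    rw [← Equiv.Perm.mul_apply, ← map_mul, mul_inv_cancel, map_one, Equiv.Perm.one_apply]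
  rw [hℓ]
  generalize projHom U⁻¹ ℓ = m at hdiag
  induction m using Projectivization.ind with
  | _ w hw =>
    obtain ⟨k, hk⟩ := Function.ne_iff.1 hw
    -- Two nonzero coordinates `k`, `l` would give the difference of the diagonal units at `k` and
    -- `l` the eigenvalues 1 and -1 on one vector.
    have hl : ∀ l, l ≠ k → w l = 0 := by
      intro l hlk
      by_contra hwl
      obtain ⟨c, hc⟩ := (isEigenline_mk hw).1 (hdiag k l)
      rw [LieAlgebra.SpecialLinear.val_singleSubSingle, ← Matrix.diagonal_single,
        ← Matrix.diagonal_single, Matrix.diagonal_sub] at hc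
      have hck := congrFun hc k
      have hcl := congrFun hc l
      rw [Matrix.mulVec_diagonal, Pi.smul_apply, smul_eq_mul] at hck hcl
      have h1 := mul_right_cancel₀ hk hck
      have h2 := mul_right_cancel₀ hwl hcl
      simp [hlk, hlk.symm] at h1 h2
      rw [← h1] at h2
      norm_num at h2
    refine ⟨k, ?_⟩
    rw [projHom_mk]
    refine (Projectivization.mk_eq_mk_iff' ℂ _ _ _ _).2 ⟨(w k)⁻¹, ?_⟩
    ext i
    rw [Pi.smul_apply, Matrix.mulVec, dotProduct, Finset.sum_eq_single k (fun l _ hl' => by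
      rw [hl l hl', mul_zero]) (fun h => absurd (Finset.mem_univ k) h), smul_eq_mul, mul_comm,
      mul_assoc, mul_inv_cancel₀ hk, mul_one]
    rfl

end Lines

/-! ### Trivial actions, and the outer nature of `A ↦ -Aᵀ` and `τ` -/

section Kernels

variable {n : ℕ}

theorem exists_eq_smul_one_of_conjAut_eq_one {g : GL (Fin n) ℂ} (hg : conjAut g = 1) :
    ∃ c : ℂ, g.val = c • 1 := by
  obtain ⟨c, hc⟩ := Matrix.mem_range_scalar_of_commute_single (M := g.val) fun i j hij => by
    have : LieAlgebra.SpecialLinear.single i j hij (1 : ℂ) =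
        conjAut g (LieAlgebra.SpecialLinear.single i j hij (1 : ℂ)) := by
      rw [hg, LieEquiv.one_apply]
    exact eq_conjAut_iff.1 this
  exact ⟨c, by rw [← hc, Matrix.scalar_apply, Matrix.smul_one_eq_diagonal]⟩

/-- A linear map for which every vector is an eigenvector is a scalar. -/
theorem exists_eq_smul_one_of_projHom_eq_one {g : GL (Fin n) ℂ} (hg : projHom g = 1) :
    ∃ c : ℂ, g.val = c • 1 := by
  obtain ⟨a, ha⟩ := (Matrix.mulVecLin g.val).exists_eq_smul_id_of_forall_notLinearIndependent
    fun v => by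
      by_cases hv : v = 0
      · simp [hv, linearIndependent_fin2]
      · rw [LinearIndependent.pair_iff' hv]
        have h := Equiv.congr_fun hg (Projectivization.mk ℂ v hv)
        rw [projHom_mk, Equiv.Perm.one_apply, Projectivization.mk_eq_mk_iff'] at h
        simpa using h
  refine ⟨a, ?_⟩
  apply Matrix.toLin'.injective
  rw [Matrix.toLin'_apply', ha, map_smul, Matrix.toLin'_one]
  rfl

theorem conjAut_eq_one {g : GL (Fin n) ℂ} {c : ℂ} (hg : g.val = c • 1) : conjAut g = 1 :=
  LieEquiv.ext fun A => by
    rw [eq_comm, LieEquiv.one_apply, eq_conjAut_iff, hg]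
    simp

theorem projHom_eq_one {g : GL (Fin n) ℂ} {c : ℂ} (hg : g.val = c • 1) : projHom g = 1 :=
  Equiv.ext fun ℓ => by
    induction ℓ using Projectivization.ind with
    | _ v hv =>
      rw [projHom_mk, Equiv.Perm.one_apply, Projectivization.mk_eq_mk_iff']
      exact ⟨c, by rw [hg, Matrix.smul_mulVec, Matrix.one_mulVec]⟩

/-- Conjugation preserves products while transposition reverses them. The units at `(i, j)` and `(j,
k)` multiply to the unit at `(i, k)`, but their transposes in the same order multiply to 0; three
distinct indices are required. -/
theorem conjAut_ne_negTransposeAut (hn : 3 ≤ n) (g : GL (Fin n) ℂ) :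
    conjAut g ≠ negTransposeAut n := by
  intro h
  have hs : ∀ i j, i ≠ j → g.val * Matrix.single i j 1 = -Matrix.single j i 1 * g.val := by
    intro i j hij
    have := DFunLike.congr_fun h (LieAlgebra.SpecialLinear.single i j hij (1 : ℂ))
    rw [eq_comm, eq_conjAut_iff, coe_negTransposeAut] at this
    rw [← LieAlgebra.SpecialLinear.val_single i j hij, ← this]
    simp
  let i : Fin n := ⟨0, by omega⟩
  let j : Fin n := ⟨1, by omega⟩
  let k : Fin n := ⟨2, by omega⟩
  have hij : i ≠ j := by simp [i, j]
  have hjk : j ≠ k := by simp [j, k]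
  have hik : i ≠ k := by simp [i, k]
  have h0 : g.val * Matrix.single i k 1 = 0 := by
    have : (Matrix.single i k 1 : Matrix (Fin n) (Fin n) ℂ) =
        Matrix.single i j 1 * Matrix.single j k 1 := by
      rw [Matrix.single_mul_single_same, mul_one]
    rw [this, ← mul_assoc, hs i j hij, mul_assoc, hs j k hjk, ← mul_assoc, neg_mul_neg,
      Matrix.single_mul_single_of_ne _ _ _ _ hik, zero_mul]
  have h1 := congrArg (g⁻¹.val * ·) h0
  simp only [Units.inv_mul_cancel_left, mul_zero] at h1
  simpa using congrFun (congrFun h1 i) k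

/-- Otherwise `g` scales two basis vectors by `a` and `b`, and its value on `e_i + z e_j` forces `z
b = a z̄` for all `z`. Taking `z = 1` and `z = I` gives `a = 0`. -/
theorem projHom_ne_conj (hn : 2 ≤ n) (g : GL (Fin n) ℂ) : projHom g ≠ conj n := by
  intro h
  have hs : ∀ v : Fin n → ℂ, v ≠ 0 → ∃ c : ℂ, c • star v = g.val *ᵥ v := by
    intro v hv
    have := Equiv.congr_fun h (Projectivization.mk ℂ v hv)
    rwa [projHom_mk, conj_mk, Projectivization.mk_eq_mk_iff'] at this
  let i : Fin n := ⟨0, by omega⟩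
  let j : Fin n := ⟨1, by omega⟩
  have hij : i ≠ j := by simp [i, j]
  have hx : (Pi.single i 1 : Fin n → ℂ) ≠ 0 := by simp
  have hne : ∀ z : ℂ, (Pi.single i 1 + z • Pi.single j 1 : Fin n → ℂ) ≠ 0 := fun z hz => by
    simpa [hij] using congrFun hz i
  obtain ⟨a, ha⟩ := hs (Pi.single i 1) (by simp)
  obtain ⟨b, hb⟩ := hs (Pi.single j 1) (by simp)
  have hz : ∀ z : ℂ, z * b = a * star z := by
    intro z
    obtain ⟨c, hc⟩ := hs _ (hne z)
    rw [Matrix.mulVec_add, Matrix.mulVec_smul, ← ha, ← hb] at hc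
    have h1 := congrFun hc i
    have h2 := congrFun hc j
    simp [hij, hij.symm] at h1 h2
    rw [h1] at h2
    simpa using h2.symm
  have h1 := hz 1
  have h2 := hz Complex.I
  simp at h1 h2
  have ha0 : a = 0 := by
    rw [h1] at h2
    have : (2 * Complex.I) * a = 0 := by linear_combination h2
    simpa using this
  rw [ha0, zero_smul] at ha
  exact mulVec_ne_zero g hx ha.symm

end Kernels

/-! ### Matrices unitary up to a scalar, and the correspondence they define -/

section Similitudes

variable {n : ℕ}

/-- The group of invertible matrices that are unitary up to a scalar. -/
def similitudes (n : ℕ) : Subgroup (GL (Fin n) ℂ) where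
  carrier := {g | ∃ c : ℂ, c ≠ 0 ∧ g.valᴴ * g.val = c • 1}
  one_mem' := ⟨1, one_ne_zero, by simp⟩
  mul_mem' := by
    rintro g h ⟨c, hc, hg⟩ ⟨d, hd, hh⟩
    refine ⟨c * d, mul_ne_zero hc hd, ?_⟩
    rw [Units.val_mul, Matrix.conjTranspose_mul, mul_assoc, ← mul_assoc g.valᴴ, hg,
      Matrix.smul_mul, one_mul, Matrix.mul_smul, hh, smul_smul]
  inv_mem' := by
    rintro g ⟨c, hc, hg⟩
    refine ⟨c⁻¹, inv_ne_zero hc, ?_⟩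
    have h1 : g⁻¹.val = c⁻¹ • g.valᴴ := by
      rw [← Units.mul_inv_cancel_right g.valᴴ g, hg, Matrix.smul_mul, one_mul, smul_smul,
        inv_mul_cancel₀ hc, one_smul]
    nth_rw 2 [h1]
    rw [Matrix.mul_smul, ← Matrix.conjTranspose_mul, Units.mul_inv, Matrix.conjTranspose_one]

/-- Entrywise complex conjugation of invertible matrices. -/
def conjGL (n : ℕ) : GL (Fin n) ℂ →* GL (Fin n) ℂ :=
  Matrix.GeneralLinearGroup.map (starRingEnd ℂ)

theorem coe_conjGL (g : GL (Fin n) ℂ) : (conjGL n g).val = g.val.map star := rfl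

theorem map_star_map_star (A : Matrix (Fin n) (Fin n) ℂ) : (A.map star).map star = A := by
  ext i j
  simp

theorem map_star_mul (A B : Matrix (Fin n) (Fin n) ℂ) :
    (A * B).map star = A.map star * B.map star :=
  Matrix.map_mul (f := starRingEnd ℂ)

theorem map_star_smul_one (c : ℂ) :
    (c • (1 : Matrix (Fin n) (Fin n) ℂ)).map star = star c • 1 := by
  ext i j
  by_cases h : i = j <;> simp [h]

theorem conjGL_mem {g : GL (Fin n) ℂ} (hg : g ∈ similitudes n) : conjGL n g ∈ similitudes n := by
  obtain ⟨c, hc, hg⟩ := hg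
  refine ⟨star c, star_ne_zero.2 hc, ?_⟩
  rw [← map_star_smul_one, ← hg, map_star_mul]
  rfl

theorem conj_mul_projHom (g : GL (Fin n) ℂ) : conj n * projHom g = projHom (conjGL n g) * conj n := by
  refine Equiv.ext fun ℓ => ?_
  induction ℓ using Projectivization.ind with
  | _ v hv =>
    simp only [Equiv.Perm.mul_apply, projHom_mk, conj_mk, coe_conjGL, map_star_mulVec]

theorem conj_mul_conj : conj n * conj n = 1 := by
  refine Equiv.ext fun ℓ => ?_
  induction ℓ using Projectivization.ind with
  | _ v hv => simp only [Equiv.Perm.mul_apply, conj_mk, star_star, Equiv.Perm.one_apply]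

theorem negTransposeAut_mul_self : negTransposeAut n * negTransposeAut n = 1 :=
  LieEquiv.ext fun A => (negTransposeAut n).symm_apply_apply A

/-- Here `g* g` is scalar, so the complex conjugate of `g` is its inverse transpose up to a scalar.
Hence `A ↦ -Aᵀ` acts on similitudes just as `τ` does in `conj_mul_projHom`. -/
theorem negTransposeAut_mul_conjAut_of_mem {g : GL (Fin n) ℂ} (hg : g ∈ similitudes n) :
    negTransposeAut n * conjAut g = conjAut (conjGL n g) * negTransposeAut n := by
  obtain ⟨c, -, hc⟩ := hg
  exact negTransposeAut_mul_conjAut hc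

/-- The subgroup generated by a subgroup and an involution normalising it. -/
def adjoinInvolution {Γ : Type*} [Group Γ] (K : Subgroup Γ) (t : Γ) (ht : t * t = 1)
    (hK : ∀ k ∈ K, t * k * t ∈ K) : Subgroup Γ where
  carrier := {x | x ∈ K ∨ x * t ∈ K}
  one_mem' := Or.inl K.one_mem
  mul_mem' := by
    rintro x y (hx | hx) (hy | hy)
    · exact Or.inl (K.mul_mem hx hy)
    · exact Or.inr (by rw [mul_assoc]; exact K.mul_mem hx hy)
    · refine Or.inr ?_
      have : x * y * t = x * t * (t * y * t) := by
        simp only [mul_assoc]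
        rw [← mul_assoc t t, ht, one_mul]
      rw [this]
      exact K.mul_mem hx (hK y hy)
    · refine Or.inl ?_
      have : x * y = x * t * (t * (y * t) * t) := by
        simp only [mul_assoc]
        rw [ht, mul_one, ← mul_assoc t t, ht, one_mul]
      rw [this]
      exact K.mul_mem hx (hK _ hy)
  inv_mem' := by
    rintro x (hx | hx)
    · exact Or.inl (K.inv_mem hx)
    · refine Or.inr ?_
      have hti : t⁻¹ = t := inv_eq_of_mul_eq_one_right ht
      have : x⁻¹ * t = t * (x * t)⁻¹ * t := by
        rw [mul_inv_rev, hti, ← mul_assoc, ht, one_mul]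
      rw [this]
      exact hK _ (K.inv_mem hx)

theorem mem_adjoinInvolution {Γ : Type*} [Group Γ] {K : Subgroup Γ} {t : Γ} {ht : t * t = 1}
    {hK : ∀ k ∈ K, t * k * t ∈ K} {x : Γ} :
    x ∈ adjoinInvolution K t ht hK ↔ x ∈ K ∨ x * t ∈ K := Iff.rfl

/-- The involution `τ` normalises the projective linear maps, so they and their coset by `τ` already
form a group. -/
theorem exists_of_mem_PGLPlus {ψ : Equiv.Perm (ℙ ℂ (Fin n → ℂ))} (hψ : ψ ∈ PGLPlus n) :
    ∃ g : GL (Fin n) ℂ, ψ = projHom g ∨ ψ = projHom g * conj n := by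
  have hK : ∀ k ∈ (projHom (n := n)).range, conj n * k * conj n ∈ (projHom (n := n)).range := by
    rintro _ ⟨g, rfl⟩
    rw [conj_mul_projHom, mul_assoc, conj_mul_conj, mul_one]
    exact ⟨_, rfl⟩
  have hle : PGLPlus n ≤ adjoinInvolution _ (conj n) conj_mul_conj hK := by
    refine sup_le ?_ ?_
    · rintro _ ⟨x, rfl⟩
      obtain ⟨g, rfl⟩ := Matrix.ProjGenLinGroup.mk_surjective x
      exact Or.inl ⟨g, rfl⟩
    · rw [Subgroup.zpowers_le]
      refine Or.inr ?_
      rw [conj_mul_conj]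
      exact Subgroup.one_mem _
  rcases hle hψ with ⟨g, hg⟩ | ⟨g, hg⟩
  · exact ⟨g, Or.inl hg.symm⟩
  · exact ⟨g, Or.inr (by rw [hg, mul_assoc, conj_mul_conj, mul_one])⟩

theorem projHom_mem_PGLPlus (g : GL (Fin n) ℂ) : projHom g ∈ PGLPlus n :=
  Subgroup.mem_sup_left ⟨Matrix.ProjGenLinGroup.mk g, rfl⟩

theorem conj_mem_PGLPlus : conj n ∈ PGLPlus n :=
  Subgroup.mem_sup_right (Subgroup.mem_zpowers _)

/-- The pair of an automorphism of `sl_n(ℂ)` and a transformation of the 1-spaces that correspond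
to a matrix. -/
def pairHom : GL (Fin n) ℂ →* (SL n ≃ₗ⁅ℂ⁆ SL n) × Equiv.Perm (ℙ ℂ (Fin n → ℂ)) :=
  conjAut.prod projHom

/-- The correspondence between automorphisms of `sl_n(ℂ)` and elements of `PGL_n(ℂ)⁺` given by the
unitary matrices and by `A ↦ -Aᵀ` on the one side, `τ` on the other. -/
def correspondence (n : ℕ) : Subgroup ((SL n ≃ₗ⁅ℂ⁆ SL n) × Equiv.Perm (ℙ ℂ (Fin n → ℂ))) :=
  adjoinInvolution ((similitudes n).map pairHom) (negTransposeAut n, conj n)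
    (Prod.ext negTransposeAut_mul_self conj_mul_conj) (by
      rintro _ ⟨g, hg, rfl⟩
      refine ⟨conjGL n g, conjGL_mem hg, Prod.ext ?_ ?_⟩
      · change conjAut (conjGL n g) = negTransposeAut n * conjAut g * negTransposeAut n
        rw [negTransposeAut_mul_conjAut_of_mem hg, mul_assoc, negTransposeAut_mul_self, mul_one]
      · change projHom (conjGL n g) = conj n * projHom g * conj n
        rw [conj_mul_projHom, mul_assoc, conj_mul_conj, mul_one])

theorem mem_correspondence {φ : SL n ≃ₗ⁅ℂ⁆ SL n} {ψ : Equiv.Perm (ℙ ℂ (Fin n → ℂ))} :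
    (φ, ψ) ∈ correspondence n ↔ ∃ g ∈ similitudes n, (φ = conjAut g ∧ ψ = projHom g) ∨
      (φ = conjAut g * negTransposeAut n ∧ ψ = projHom g * conj n) := by
  rw [correspondence, mem_adjoinInvolution]
  constructor
  · rintro (⟨g, hg, h⟩ | ⟨g, hg, h⟩)
    · exact ⟨g, hg, Or.inl ⟨(congrArg Prod.fst h).symm, (congrArg Prod.snd h).symm⟩⟩
    · refine ⟨g, hg, Or.inr ⟨?_, ?_⟩⟩
      · have h1 : conjAut g = φ * negTransposeAut n := congrArg Prod.fst h
        rw [h1, mul_assoc, negTransposeAut_mul_self, mul_one]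
      · have h1 : projHom g = ψ * conj n := congrArg Prod.snd h
        rw [h1, mul_assoc, conj_mul_conj, mul_one]
  · rintro ⟨g, hg, ⟨rfl, rfl⟩ | ⟨rfl, rfl⟩⟩
    · exact Or.inl ⟨g, hg, rfl⟩
    · refine Or.inr ⟨g, hg, Prod.ext ?_ ?_⟩
      · change conjAut g = conjAut g * negTransposeAut n * negTransposeAut n
        rw [mul_assoc, negTransposeAut_mul_self, mul_one]
      · change projHom g = projHom g * conj n * conj n
        rw [mul_assoc, conj_mul_conj, mul_one]

theorem snd_eq_one_of_mem_correspondence (hn : 3 ≤ n) {ψ : Equiv.Perm (ℙ ℂ (Fin n → ℂ))}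
    (h : (1, ψ) ∈ correspondence n) : ψ = 1 := by
  obtain ⟨g, -, ⟨h1, rfl⟩ | ⟨h1, rfl⟩⟩ := mem_correspondence.1 h
  · obtain ⟨c, hc⟩ := exists_eq_smul_one_of_conjAut_eq_one h1.symm
    exact projHom_eq_one hc
  · refine absurd ?_ (conjAut_ne_negTransposeAut hn g)
    rw [← one_mul (negTransposeAut n), h1, mul_assoc, negTransposeAut_mul_self, mul_one]

theorem fst_eq_one_of_mem_correspondence (hn : 2 ≤ n) {φ : SL n ≃ₗ⁅ℂ⁆ SL n}
    (h : (φ, 1) ∈ correspondence n) : φ = 1 := by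
  obtain ⟨g, -, ⟨rfl, h1⟩ | ⟨rfl, h1⟩⟩ := mem_correspondence.1 h
  · obtain ⟨c, hc⟩ := exists_eq_smul_one_of_projHom_eq_one h1.symm
    exact conjAut_eq_one hc
  · refine absurd ?_ (projHom_ne_conj hn g)
    rw [← one_mul (conj n), h1, mul_assoc, conj_mul_conj, mul_one]

/-- If an invertible matrix sends the columns of a matrix to distinct lines of an orthonormal
basis, the columns are pairwise orthogonal for its Gram matrix. -/
theorem conjTranspose_mul_mul_mul_eq_diagonal
    (b : OrthonormalBasis (Fin n) ℂ (EuclideanSpace ℂ (Fin n)))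
    (g : GL (Fin n) ℂ) (F : Matrix (Fin n) (Fin n) ℂ)
    (σ : Fin n → Fin n) (hσ : Function.Injective σ)
    (hF : ∀ k, ∃ a : ℂ, a • (b (σ k)).ofLp = g.val *ᵥ F.col k) :
    ∃ d, (g.val * F)ᴴ * (g.val * F) = Matrix.diagonal d := by
  choose a ha using hF
  have hcol : g.val * F = (basisGL b).val.submatrix id σ * Matrix.diagonal a := by
    ext i k
    rw [Matrix.mul_diagonal, Matrix.submatrix_apply, basisGL_apply, mul_comm]
    exact (congrFun (ha k) i).symm
  have h1 : ((basisGL b).val.submatrix id σ)ᴴ * (basisGL b).val.submatrix id σ = 1 := by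
    rw [Matrix.conjTranspose_submatrix, ← Matrix.submatrix_mul _ _ _ _ _ Function.bijective_id,
      conjTranspose_basisGL_mul, Matrix.submatrix_one _ hσ]
  rw [hcol, Matrix.conjTranspose_mul, mul_assoc, ← mul_assoc _ᴴ _ (Matrix.diagonal a), h1, one_mul,
    Matrix.diagonal_conjTranspose, Matrix.diagonal_mul_diagonal]
  exact ⟨_, rfl⟩

/-- As `F` is unitary, diagonality of `F* (g* g) F` means that the columns of `F` are eigenvectors
of `g* g`. -/
theorem exists_mul_eq_mul_diagonal (b : OrthonormalBasis (Fin n) ℂ (EuclideanSpace ℂ (Fin n)))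
    (g : GL (Fin n) ℂ) (F : GL (Fin n) ℂ) (hFu : F.valᴴ * F.val = 1)
    (σ : Fin n → Fin n) (hσ : Function.Injective σ)
    (hF : ∀ k, ∃ a : ℂ, a • (b (σ k)).ofLp = g.val *ᵥ F.val.col k) :
    ∃ d, g.valᴴ * g.val * F.val = F.val * Matrix.diagonal d := by
  obtain ⟨d, hd⟩ := conjTranspose_mul_mul_mul_eq_diagonal b g F.val σ hσ hF
  refine ⟨d, ?_⟩
  rw [← hd, Matrix.conjTranspose_mul, mul_assoc F.valᴴ, ← mul_assoc F.val, mul_eq_one_comm.1 hFu,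
    one_mul, mul_assoc]

/-- A transformation of 1-spaces mapping an orthoframe into another one permutes their lines. -/
theorem exists_injective_of_image_eq {b b' : OrthonormalBasis (Fin n) ℂ (EuclideanSpace ℂ (Fin n))}
    {ψ : Equiv.Perm (ℙ ℂ (Fin n → ℂ))} (h : ψ '' Ort b = Ort b') :
    ∃ σ : Fin n → Fin n, Function.Injective σ ∧ ∀ k, ψ (line b k) = line b' (σ k) := by
  have hex : ∀ k, ∃ l, line b' l = ψ (line b k) := fun k => by
    have : ψ (line b k) ∈ Ort b' := h ▸ Set.mem_image_of_mem ψ ⟨k, rfl⟩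
    exact this
  choose σ hσ using hex
  exact ⟨σ, fun k l hkl => line_injective b (ψ.injective (by rw [← hσ, ← hσ, hkl])),
    fun k => (hσ k).symm⟩

theorem exists_gram_mul_basisGL {b b' : OrthonormalBasis (Fin n) ℂ (EuclideanSpace ℂ (Fin n))}
    {g : GL (Fin n) ℂ} (h : projHom g '' Ort b = Ort b') :
    ∃ d, g.valᴴ * g.val * (basisGL b).val = (basisGL b).val * Matrix.diagonal d := by
  obtain ⟨σ, hσ, hline⟩ := exists_injective_of_image_eq h
  exact exists_mul_eq_mul_diagonal b' g (basisGL b) (conjTranspose_basisGL_mul b) σ hσ fun k =>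
    (Projectivization.mk_eq_mk_iff' ℂ _ _ _ _).1 (hline k)

/-- The matrix `g` itself acts on the conjugate basis, which therefore diagonalises `g* g`;
conjugating the equation returns to `b`. -/
theorem exists_gram_mul_basisGL_of_conj
    {b b' : OrthonormalBasis (Fin n) ℂ (EuclideanSpace ℂ (Fin n))}
    {g : GL (Fin n) ℂ} (h : (projHom g * conj n) '' Ort b = Ort b') :
    ∃ d, (g.valᴴ * g.val).map star * (basisGL b).val = (basisGL b).val * Matrix.diagonal d := by
  obtain ⟨σ, hσ, hline⟩ := exists_injective_of_image_eq h
  obtain ⟨d, hd⟩ := exists_mul_eq_mul_diagonal b' g (conjGL n (basisGL b)) (by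
    change (basisGL b).valᴴ.map star * (basisGL b).val.map star = 1
    rw [← map_star_mul, conjTranspose_basisGL_mul]
    exact Matrix.map_one _ (star_zero _) (star_one _)) σ hσ fun k =>
    (Projectivization.mk_eq_mk_iff' ℂ _ _ _ _).1 (hline k)
  refine ⟨star d, ?_⟩
  have := congrArg (fun M => M.map star) hd
  simp only [map_star_mul, coe_conjGL, map_star_map_star,
    Matrix.diagonal_map (star_zero ℂ)] at this
  rw [map_star_mul]
  exact this

end Similitudes

/-! ### Matching the automorphisms of the decomposition and of the bases -/

section Decomposition

variable {n : ℕ} {D : OrthogonalDecomposition n} {ℬ : CompleteMUB n}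

theorem Corresponds.mem_H_iff (h : Corresponds D ℬ) (i : Fin (n + 1)) (A : SL n) :
    A ∈ (D.H i : Set (SL n)) ↔ ∀ ℓ ∈ Ort (ℬ.B i), IsEigenline A.val ℓ := by
  rw [SetLike.mem_coe, h i A, Ort, Set.forall_mem_range]
  simp only [isEigenline_line]

theorem Corresponds.mem_Ort_iff (h : Corresponds D ℬ) (i : Fin (n + 1)) (ℓ : ℙ ℂ (Fin n → ℂ)) :
    ℓ ∈ Ort (ℬ.B i) ↔ ∀ A ∈ (D.H i : Set (SL n)), IsEigenline A.val ℓ :=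
  ⟨fun hℓ A hA => (h.mem_H_iff i A).1 hA ℓ hℓ, fun hℓ =>
    mem_Ort_of_forall_isEigenline _ fun A hA => hℓ A ((h.mem_H_iff i A).2 hA)⟩

theorem Corresponds.image_conjAut_iff (h : Corresponds D ℬ) (g : GL (Fin n) ℂ)
    (i j : Fin (n + 1)) :
    conjAut g '' (D.H i : Set (SL n)) = D.H j ↔ projHom g '' Ort (ℬ.B i) = Ort (ℬ.B j) :=
  image_eq_iff (h.mem_H_iff i) (h.mem_Ort_iff i) (h.mem_H_iff j) (h.mem_Ort_iff j)
    (conjAut g).toLinearEquiv.toEquiv (projHom g) (isEigenline_conjAut g)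

/-- The two maps differ by `A ↦ -A*`, which preserves `H i`. Thus the linear map `A ↦ -Aᵀ` may be
replaced on the level of sets by the semilinear one compatible with `τ`. -/
theorem image_negTransposeAut (hD : D.IsAdjointClosed) (i : Fin (n + 1)) :
    negTransposeAut n '' (D.H i : Set (SL n)) = conjEquiv n '' (D.H i : Set (SL n)) := by
  have h : ∀ A ∈ D.H i, adjoint A ∈ D.H i := fun A hA => by
    have : adjoint A ∈ (D.H i : Set (SL n)) := hD i ▸ Set.mem_image_of_mem adjoint hA
    exact this
  apply Set.Subset.antisymm
  · rintro _ ⟨A, hA, rfl⟩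
    refine ⟨-adjoint A, (D.H i).neg_mem (h A hA), ?_⟩
    ext a b
    simp [coe_conjEquiv, coe_negTransposeAut, adjoint]
  · rintro _ ⟨A, hA, rfl⟩
    refine ⟨-adjoint A, (D.H i).neg_mem (h A hA), ?_⟩
    ext a b
    simp [coe_conjEquiv, coe_negTransposeAut, adjoint]

theorem Corresponds.image_conjAut_mul_iff (h : Corresponds D ℬ) (hD : D.IsAdjointClosed)
    (g : GL (Fin n) ℂ) (i j : Fin (n + 1)) :
    (conjAut g * negTransposeAut n) '' (D.H i : Set (SL n)) = D.H j ↔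
      (projHom g * conj n) '' Ort (ℬ.B i) = Ort (ℬ.B j) := by
  have h1 : (conjAut g * negTransposeAut n) '' (D.H i : Set (SL n)) =
      ((conjEquiv n).trans (conjAut g).toLinearEquiv.toEquiv) '' (D.H i : Set (SL n)) := by
    change (conjAut g ∘ negTransposeAut n) '' _ = (conjAut g ∘ conjEquiv n) '' _
    rw [Set.image_comp, Set.image_comp, image_negTransposeAut hD]
  rw [h1]
  exact image_eq_iff (h.mem_H_iff i) (h.mem_Ort_iff i) (h.mem_H_iff j) (h.mem_Ort_iff j) _ _
    fun A ℓ => (isEigenline_conjAut g _ _).trans (isEigenline_conjEquiv A ℓ)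

/-- A matrix that is diagonal with respect to all the bases is scalar. -/
theorem Corresponds.exists_eq_smul_one (h : Corresponds D ℬ) [NeZero n]
    {M : Matrix (Fin n) (Fin n) ℂ}
    (hM : ∀ i, ∃ d, M * (basisGL (ℬ.B i)).val = (basisGL (ℬ.B i)).val * Matrix.diagonal d) :
    ∃ c : ℂ, M = c • 1 := by
  have hmem : ∀ i, tracelessPart n M ∈ D.H i := fun i => by
    obtain ⟨d, hd⟩ := hM i
    rw [← SetLike.mem_coe, h.mem_H_iff, ← exists_mul_basisGL_eq_iff]
    refine ⟨fun k => d k - M.trace / n, ?_⟩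
    rw [coe_tracelessPart, sub_mul, hd, ← Matrix.diagonal_sub, mul_sub,
      ← Matrix.smul_one_eq_diagonal, Matrix.smul_mul, Matrix.mul_smul, one_mul, mul_one]
  -- Two distinct summands of the direct sum already meet trivially.
  have hdis := D.isInternal.submodule_iSupIndep.pairwiseDisjoint
    (show (0 : Fin (n + 1)) ≠ Fin.last n from (Fin.last_pos' (n := n)).ne)
  have h0 : tracelessPart n M = 0 :=
    Submodule.disjoint_def.1 hdis _ (hmem 0) (hmem (Fin.last n))
  have h1 := congrArg Subtype.val h0
  rw [coe_tracelessPart] at h1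
  exact ⟨_, sub_eq_zero.1 h1⟩

theorem mem_similitudes_of_eq_smul_one [NeZero n] {g : GL (Fin n) ℂ} {c : ℂ}
    (h : g.valᴴ * g.val = c • 1) : g ∈ similitudes n := by
  refine ⟨c, ?_, h⟩
  rintro rfl
  rw [zero_smul] at h
  have : g.valᴴ = 0 := by
    rw [← Units.mul_inv_cancel_right g.valᴴ g, h, zero_mul]
  exact g.ne_zero (by rw [← Matrix.conjTranspose_eq_zero, this])

/-- Images of orthogonal lines of `B i` are again orthogonal, so `g* g` is diagonal in each `B i`
and hence scalar. -/
theorem Corresponds.mem_similitudes (h : Corresponds D ℬ) [NeZero n] {g : GL (Fin n) ℂ}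
    (hg : ∀ i, ∃ j, projHom g '' Ort (ℬ.B i) = Ort (ℬ.B j)) : g ∈ similitudes n := by
  obtain ⟨c, hc⟩ := h.exists_eq_smul_one fun i => by
    obtain ⟨j, hj⟩ := hg i
    exact exists_gram_mul_basisGL hj
  exact mem_similitudes_of_eq_smul_one hc

theorem Corresponds.mem_similitudes_of_conj (h : Corresponds D ℬ) [NeZero n] {g : GL (Fin n) ℂ}
    (hg : ∀ i, ∃ j, (projHom g * conj n) '' Ort (ℬ.B i) = Ort (ℬ.B j)) : g ∈ similitudes n := by
  obtain ⟨c, hc⟩ := h.exists_eq_smul_one fun i => by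
    obtain ⟨j, hj⟩ := hg i
    exact exists_gram_mul_basisGL_of_conj hj
  refine mem_similitudes_of_eq_smul_one (c := star c) ?_
  rw [← map_star_smul_one, ← hc, map_star_map_star]

theorem Corresponds.exists_eq_conjAut (h : Corresponds D ℬ) (hn : 3 ≤ n)
    {φ : SL n ≃ₗ⁅ℂ⁆ SL n} (hφ : φ ∈ D.Aut) :
    ∃ g : GL (Fin n) ℂ, φ = conjAut g ∨ φ = conjAut g * negTransposeAut n := by
  obtain ⟨j, hj⟩ := hφ 0
  refine MUB.exists_eq_conjAut hn φ (basisGL (ℬ.B 0)) (basisGL (ℬ.B j)) fun A hA => ?_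
  rw [exists_mul_basisGL_eq_iff, ← h.mem_H_iff] at hA ⊢
  rw [← hj]
  exact Set.mem_image_of_mem φ hA

theorem Corresponds.exists_aut_bases (h : Corresponds D ℬ) (hD : D.IsAdjointClosed)
    (hn : 3 ≤ n) (φ : D.Aut) : ∃ ψ : ℬ.Aut, (φ.1, ψ.1.1) ∈ correspondence n := by
  have : NeZero n := ⟨by omega⟩
  obtain ⟨φ, hφ⟩ := φ
  obtain ⟨g, rfl | rfl⟩ := h.exists_eq_conjAut hn hφ
  · have hψ : ∀ i, ∃ j, projHom g '' Ort (ℬ.B i) = Ort (ℬ.B j) := fun i =>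
      (hφ i).imp fun j => (h.image_conjAut_iff g i j).1
    exact ⟨⟨⟨projHom g, projHom_mem_PGLPlus g⟩, hψ⟩,
      mem_correspondence.2 ⟨g, h.mem_similitudes hψ, Or.inl ⟨rfl, rfl⟩⟩⟩
  · have hψ : ∀ i, ∃ j, (projHom g * conj n) '' Ort (ℬ.B i) = Ort (ℬ.B j) := fun i =>
      (hφ i).imp fun j => (h.image_conjAut_mul_iff hD g i j).1
    exact ⟨⟨⟨projHom g * conj n, mul_mem (projHom_mem_PGLPlus g) conj_mem_PGLPlus⟩, hψ⟩,
      mem_correspondence.2 ⟨g, h.mem_similitudes_of_conj hψ, Or.inr ⟨rfl, rfl⟩⟩⟩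

theorem Corresponds.exists_aut_decomposition (h : Corresponds D ℬ) (hD : D.IsAdjointClosed)
    [NeZero n] (ψ : ℬ.Aut) : ∃ φ : D.Aut, (φ.1, ψ.1.1) ∈ correspondence n := by
  obtain ⟨⟨ψ, hψ⟩, hψ'⟩ := ψ
  replace hψ' : ∀ i, ∃ j, ψ '' Ort (ℬ.B i) = Ort (ℬ.B j) := hψ'
  obtain ⟨g, rfl | rfl⟩ := exists_of_mem_PGLPlus hψ
  · exact ⟨⟨conjAut g, fun i => (hψ' i).imp fun j => (h.image_conjAut_iff g i j).2⟩,
      mem_correspondence.2 ⟨g, h.mem_similitudes hψ', Or.inl ⟨rfl, rfl⟩⟩⟩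
  · exact ⟨⟨conjAut g * negTransposeAut n,
        fun i => (hψ' i).imp fun j => (h.image_conjAut_mul_iff hD g i j).2⟩,
      mem_correspondence.2 ⟨g, h.mem_similitudes_of_conj hψ', Or.inr ⟨rfl, rfl⟩⟩⟩

/-- The correspondence restricted to the automorphism groups of a decomposition and of a complete
set of mutually unbiased bases. -/
def autCorrespondence (D : OrthogonalDecomposition n) (ℬ : CompleteMUB n) :
    Subgroup (D.Aut × ℬ.Aut) :=
  (correspondence n).comap (D.Aut.subtype.prodMap ((PGLPlus n).subtype.comp ℬ.Aut.subtype))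

end Decomposition
end MUB

end

/-- For `n ≥ 3`: if `D` is an orthogonal decomposition of `sl_n(ℂ)` into Cartan subalgebras closed
under the adjoint, and `ℬ` is the corresponding complete set of MUBs, then the automorphism groups
of `D` and of `ℬ` are isomorphic. -/
theorem theorem2p2 (n : ℕ) (hn : 3 ≤ n) (D : MUB.OrthogonalDecomposition n)
    (hD : D.IsAdjointClosed) (ℬ : MUB.CompleteMUB n) (hDℬ : MUB.Corresponds D ℬ) :
    Nonempty (D.Aut ≃* ℬ.Aut) := by
  have : NeZero n := ⟨by omega⟩
  set R := MUB.autCorrespondence D ℬ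
  -- A subgroup of a product that projects bijectively onto both factors is the graph of an
  -- isomorphism; injectivity is checked on kernels.
  have h1 : Function.Bijective (Prod.fst ∘ R.subtype) := by
    constructor
    · refine (injective_iff_map_eq_one ((MonoidHom.fst D.Aut ℬ.Aut).comp R.subtype)).2 ?_
      rintro ⟨⟨φ, ψ⟩, hx⟩ (rfl : φ = 1)
      have hψ : ψ = 1 :=
        Subtype.ext (Subtype.ext (MUB.snd_eq_one_of_mem_correspondence hn hx))
      subst hψ
      rfl
    · intro φ
      obtain ⟨ψ, hψ⟩ := hDℬ.exists_aut_bases hD hn φ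
      exact ⟨⟨(φ, ψ), hψ⟩, rfl⟩
  have h2 : Function.Bijective (Prod.snd ∘ R.subtype) := by
    constructor
    · refine (injective_iff_map_eq_one ((MonoidHom.snd D.Aut ℬ.Aut).comp R.subtype)).2 ?_
      rintro ⟨⟨φ, ψ⟩, hx⟩ (rfl : ψ = 1)
      have hφ : φ = 1 :=
        Subtype.ext (MUB.fst_eq_one_of_mem_correspondence (by omega) hx)
      subst hφ
      rfl
    · intro ψ
      obtain ⟨φ, hφ⟩ := hDℬ.exists_aut_decomposition hD ψ
      exact ⟨⟨(φ, ψ), hφ⟩, rfl⟩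
  obtain ⟨e, -⟩ := Subgroup.exists_mulEquiv_eq_graph h1 h2
  exact ⟨e⟩
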